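/- Let $n\ge 0$ and let $\eta_0,\dots,\eta_n$ be real i.i.d. random variables with $\mathbb E[\eta_k]=0$, $\mathbb E[\eta_k^2]=1$ and common characteristic function $\phi(s)=\mathbb E[e^{is\eta_k}]$. Let $f_0,\dots,f_n$ be entire functions that are real valued on the real line, and put $P_n(z)=\sum_{k=0}^n\eta_kf_k(z)$. For $x\in\mathbb R$ let $$K_n=\sum_{j=0}^n f_j(x)^2,\quad K_n^{(0,1)}=\sum_{j=0}^n f_j(x)f_j'(x),\quad K_n^{(1,1)}=\sum_{j=0}^n f_j'(x)^2,\quad \mathcal K_n(x)=\frac{\sqrt{K_n^{(1,1)}K_n-(K_n^{(0,1)})^2}}{K_n}.$$ Suppose that for some $a>0$, $q\ge 1$ we have $|\phi(s)|\le (1+as^2)^{-q}$ for all $s\in\mathbb R$, and that $\phi$ is three times differentiable with $|\phi''(s)|\le C_2$ and $|\phi'''(s)|\le C_3$ for all $s\in\mathbb R$, where $C_2,C_3>0$ are constants. Then the expected number of real zeros of $P_n$ has a density $\rho_n\ge 0$ on $\{x\in\mathbb R: K_n\ne 0\}$: for every Borel set $S$ contained in this set, the expected number of zeros of $P_n$ in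 $S$ equals $\int_S\rho_n(x)\,dx$; and at every $x$ with $K_n\neq 0$ and $K_n^{(1,1)}K_n-(K_n^{(0,1)})^2\ne 0$ the pair $(P_n(x),P_n'(x))$ has a continuous joint density $D_n(\xi,\eta;x)$ and $\rho_n(x)=\int_{\mathbb R}|\eta|\,D_n(0,\eta;x)\,d\eta<\infty$. This density can be chosen such that for every $x\in\mathbb R$ with $K_n\ne 0$ $$\rho_n(x)\le \mathcal K_n(x)\,\frac1{aq}\left[k_1+C_3k_2+\frac{1}{\sqrt{aq}}\,C_2\,(k_3+C_2k_4)\right],$$ where $$k_1=\frac1\pi\Big(1-\log 2+\frac{\pi\sqrt3+\log 8}{9}\Big)\approx 0.36,\qquad k_2=\frac{\pi\sqrt3+\log 8}{9\pi}\approx 0.27,$$ $$k_3=\frac{1-\log 2}{\sqrt2}\approx 0.22,\qquad k_4=\frac{\sqrt2}{9}(\pi\sqrt3+\log 8)\approx 1.18 .$$ -/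

import Mathlib

open MeasureTheory ProbabilityTheory
open scoped ENNReal

noncomputable section

namespace RandomSum

/-- `K_n(x,x) = ∑ f_j(x)^2` for functions `f_j` that are real on the real line. -/
def K {n : ℕ} (f : Fin (n + 1) → ℂ → ℂ) (x : ℝ) : ℝ :=
  ∑ j, (f j x).re ^ 2

/-- `K_n^{(0,1)}(x,x) = ∑ f_j(x) f_j'(x)`. -/
def K01 {n : ℕ} (f : Fin (n + 1) → ℂ → ℂ) (x : ℝ) : ℝ :=
  ∑ j, (f j x).re * (deriv (f j) x).re

/-- `K_n^{(1,1)}(x,x) = ∑ f_j'(x)^2`. -/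
def K11 {n : ℕ} (f : Fin (n + 1) → ℂ → ℂ) (x : ℝ) : ℝ :=
  ∑ j, (deriv (f j) x).re ^ 2

/-- `𝒦_n(x) = √(K_n^{(1,1)} K_n - (K_n^{(0,1)})^2) / K_n`. -/
def scriptK {n : ℕ} (f : Fin (n + 1) → ℂ → ℂ) (x : ℝ) : ℝ :=
  √(K11 f x * K f x - K01 f x ^ 2) / K f x

/-- The random sum `P_n(z) = ∑ η_k f_k(z)`. -/
def P {Ω : Type*} {n : ℕ} (η : Fin (n + 1) → Ω → ℝ) (f : Fin (n + 1) → ℂ → ℂ)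
    (ω : Ω) (z : ℂ) : ℂ :=
  ∑ k, (η k ω : ℂ) * f k z

/-- The number of real zeros of `P_n` in the set `S ⊆ ℝ`. -/
def zeroCount {Ω : Type*} {n : ℕ} (η : Fin (n + 1) → Ω → ℝ) (f : Fin (n + 1) → ℂ → ℂ)
    (S : Set ℝ) (ω : Ω) : ℝ≥0∞ :=
  ({x : ℝ | x ∈ S ∧ P η f ω x = 0}.encard : ℝ≥0∞)

/-- `D` is the continuous joint probability density of `X` and `Y`. (There is at most one, so
that its values on the null set `{0} × ℝ` are meaningful.) -/
def IsJointDensity {Ω : Type*} [MeasurableSpace Ω] (μ : Measure Ω) (X Y : Ω → ℝ)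
    (D : ℝ × ℝ → ℝ) : Prop :=
  Continuous D ∧ (∀ p, 0 ≤ D p) ∧
    μ.map (fun ω => (X ω, Y ω)) = volume.withDensity (fun p => ENNReal.ofReal (D p))

/-- `ρ` is the density function of the expected number of real zeros of `P_n`.  It is considered
at the points where `K_n(x,x) ≠ 0`; a zero of `K_n(x,x)` is a common zero of all the `f_k`. -/
structure IsRealZeroDensity {Ω : Type*} [MeasurableSpace Ω] (μ : Measure Ω) {n : ℕ}
    (η : Fin (n + 1) → Ω → ℝ) (f : Fin (n + 1) → ℂ → ℂ) (ρ : ℝ → ℝ) : Prop where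
  measurable : Measurable ρ
  nonneg : ∀ x, 0 ≤ ρ x
  /-- The number of zeros in a Borel set is a random variable. -/
  aemeasurable_zeroCount : ∀ S : Set ℝ, MeasurableSet S → (∀ x ∈ S, K f x ≠ 0) →
    AEMeasurable (zeroCount η f S) μ
  /-- `𝔼[N_n(S)] = ∫_S ρ(x) dx`. -/
  lintegral_zeroCount : ∀ S : Set ℝ, MeasurableSet S → (∀ x ∈ S, K f x ≠ 0) →
    ∫⁻ ω, zeroCount η f S ω ∂μ = ∫⁻ x in S, ENNReal.ofReal (ρ x)
  /-- `ρ(x) = ∫ |y| D_n(0,y;x) dy`, with `D_n(·,·;x)` the joint density of `P_n(x)` and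
  `P_n'(x)`, at every point where these two are linearly independent. This fixes `ρ`
  pointwise there and not merely almost everywhere. -/
  kac_rice : ∀ x : ℝ, K f x ≠ 0 → K11 f x * K f x - K01 f x ^ 2 ≠ 0 →
    ∃ D : ℝ × ℝ → ℝ,
      IsJointDensity μ (fun ω => (P η f ω x).re) (fun ω => (deriv (P η f ω) x).re) D ∧
      Integrable (fun y : ℝ => |y| * D (0, y)) ∧
      ρ x = ∫ y : ℝ, |y| * D (0, y)

/-- `k₁ ≈ 0.36`. -/
def k₁ : ℝ :=
  1 / Real.pi * (1 - Real.log 2 + (Real.pi * √3 + Real.log 8) / 9)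

/-- `k₂ ≈ 0.27`. -/
def k₂ : ℝ := 1 / (9 * Real.pi) * (Real.pi * √3 + Real.log 8)

/-- `k₃ ≈ 0.21`. -/
def k₃ : ℝ := 1 / √2 * (1 - Real.log 2)

/-- `k₄ ≈ 1.18`. -/
def k₄ : ℝ := √2 / 9 * (Real.pi * √3 + Real.log 8)

end RandomSum

end

/-!
On the set where `g k ≠ 0`, the zeros `x` of `∑ j, v j * g j x` are the `k`-th coordinates of the
preimages of `v` under the map of `ℝⁿ⁺¹` that reads its `k`-th coordinate as a point `x` and
replaces it by the solution of `∑ j, v j * g j x = 0`. The area formula for this map gives the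
Kac–Rice formula, with the intensity at `x` equal to the integral of `|∑ j, v j * g' j x|` over the
slice `∑ j, v j * g j x = 0` of the law of the coefficients.

On the slice, `g'` may be replaced by `c = g' - τ • g` for any real `τ`. A sum of `v j * c j` over a
set `A` of indices is independent of the part of `∑ j, v j * g j` outside `A`. Its first absolute
moment is at most `(∑ j ∈ A, c j ^ 2) ^ (1 / 2)`, and Fourier inversion bounds the density of the
other part: its characteristic function is at most `1 / (1 + b * G * s ^ 2)`, where `b = a * q` by
Bernoulli's inequality and `G = ∑ j ∉ A, g j ^ 2`, so its density is at most `1 / (2 * √(b * G))`.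
If a single `g m ^ 2` is at least a third of `∑ j, g j ^ 2`, choose `τ` with `c m = 0` and let `A`
be the complement of `{m}`. Otherwise, split the indices into two sets, each carrying at least a
third of `∑ j, g j ^ 2`, choose `τ` with `c` orthogonal to `g`, and apply the estimate to both
sets. In either case the intensity is at most `√3 / √b * 𝒦`.

Finally, `1 - s ^ 2 / 2 ≤ ‖φ s‖ ≤ 1 / (1 + b * s ^ 2)` forces `b ≤ 9 / 17`, and
`C₂ ≥ ‖φ'' 0‖ = 1`, so that already the last term of the asserted bound dominates `√3 / √b * 𝒦`.
-/

open Filter Topology FourierTransform Set Function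

section FourierInversion

open Module

variable {E : Type*} [NormedAddCommGroup E] [InnerProductSpace ℝ E]

/-- The probability density whose Fourier transform is `s ↦ exp (-‖s‖² / c)`; convolution with it
regularizes a measure as `c → ∞`. -/
noncomputable def gaussianKernel (c : ℝ) (x : E) : ℝ :=
  (Real.pi * c) ^ (finrank ℝ E / 2 : ℝ) * Real.exp (-(Real.pi ^ 2 * c) * ‖x‖ ^ 2)

lemma gaussianKernel_nonneg {c : ℝ} (hc : 0 < c) (x : E) : 0 ≤ gaussianKernel c x := by
  unfold gaussianKernel
  positivity

@[fun_prop]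
lemma continuous_gaussianKernel (c : ℝ) : Continuous (gaussianKernel c : E → ℝ) := by
  unfold gaussianKernel
  fun_prop

lemma gaussianKernel_le {c : ℝ} (hc : 0 < c) (x : E) :
    gaussianKernel c x ≤ (Real.pi * c) ^ (finrank ℝ E / 2 : ℝ) :=
  mul_le_of_le_one_right (by positivity) <| Real.exp_le_one_iff.2 <|
    mul_nonpos_of_nonpos_of_nonneg (neg_nonpos.2 (by positivity)) (by positivity)

variable [FiniteDimensional ℝ E] [MeasurableSpace E] [BorelSpace E]

lemma lintegral_gaussianKernel {c : ℝ} (hc : 0 < c) :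
    ∫⁻ x : E, ENNReal.ofReal (gaussianKernel c x) = 1 := by
  have hb : 0 < Real.pi ^ 2 * c := by positivity
  have hint := GaussianFourier.integral_rexp_neg_mul_sq_norm (V := E) hb
  have hpos : 0 < (Real.pi / (Real.pi ^ 2 * c)) ^ (finrank ℝ E / 2 : ℝ) := by positivity
  rw [← ofReal_integral_eq_lintegral_ofReal]
  · simp only [gaussianKernel, integral_const_mul, hint]
    rw [← Real.mul_rpow (by positivity) (by positivity),
      show Real.pi * c * (Real.pi / (Real.pi ^ 2 * c)) = 1 by field_simp, Real.one_rpow,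
      ENNReal.ofReal_one]
  · exact (Integrable.of_integral_ne_zero (hint.trans_ne hpos.ne')).const_mul _
  · exact ae_of_all _ (gaussianKernel_nonneg hc)

/-- The Fourier inversion integral `(2π)⁻ᵈ ∫ exp (-i⟪s, x⟫) φ(s) ds` of the characteristic function
`φ` of `ν`: the density of `ν` if `φ` is integrable. -/
noncomputable def charFunDensity (ν : Measure E) (x : E) : ℝ :=
  (𝓕 (fun s => charFun ν ((2 * Real.pi) • s)) x).re

lemma continuous_charFunDensity {ν : Measure E} (h : Integrable (charFun ν)) :
    Continuous (charFunDensity ν) :=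
  Complex.continuous_re.comp <| VectorFourier.fourierIntegral_continuous
    Real.continuous_fourierChar (L := innerₗ E) continuous_inner
    (h.comp_smul (R := 2 * Real.pi) (by positivity))

lemma charFunDensity_le_integral_norm_charFun (ν : Measure E) (x : E) :
    charFunDensity ν x ≤ (2 * Real.pi)⁻¹ ^ finrank ℝ E * ∫ s, ‖charFun ν s‖ := by
  calc charFunDensity ν x ≤ ‖𝓕 (fun s => charFun ν ((2 * Real.pi) • s)) x‖ := Complex.re_le_norm _
    _ ≤ ∫ s, ‖charFun ν ((2 * Real.pi) • s)‖ :=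
        VectorFourier.norm_fourierIntegral_le_integral_norm ..
    _ = (2 * Real.pi)⁻¹ ^ finrank ℝ E * ∫ s, ‖charFun ν s‖ := by
        rw [Measure.integral_comp_smul _ fun s => ‖charFun ν s‖, smul_eq_mul, inv_pow,
          abs_of_pos (by positivity)]

variable (ν : Measure E) [IsProbabilityMeasure ν]

lemma integrable_gaussianKernel_sub {c : ℝ} (hc : 0 < c) (x : E) :
    Integrable (fun y => gaussianKernel c (x - y)) ν :=
  Integrable.of_bound (by fun_prop) ((Real.pi * c) ^ (finrank ℝ E / 2 : ℝ)) <| ae_of_all _ fun y =>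
    (Real.norm_of_nonneg (gaussianKernel_nonneg hc _)).trans_le (gaussianKernel_le hc _)

lemma lintegral_integral_gaussianKernel {c : ℝ} (hc : 0 < c) :
    ∫⁻ x, ENNReal.ofReal (∫ y, gaussianKernel c (x - y) ∂ν) = 1 := by
  calc ∫⁻ x, ENNReal.ofReal (∫ y, gaussianKernel c (x - y) ∂ν)
      = ∫⁻ x, ∫⁻ y, ENNReal.ofReal (gaussianKernel c (x - y)) ∂ν := by
        refine lintegral_congr fun x => ?_
        exact ofReal_integral_eq_lintegral_ofReal (integrable_gaussianKernel_sub ν hc x)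
          (ae_of_all _ fun y => gaussianKernel_nonneg hc _)
    _ = ∫⁻ y, (∫⁻ x, ENNReal.ofReal (gaussianKernel c (x - y))) ∂ν :=
        lintegral_lintegral_swap (by fun_prop)
    _ = 1 := by
        simp_rw [lintegral_sub_right_eq_self fun x : E => ENNReal.ofReal (gaussianKernel c x),
          lintegral_gaussianKernel hc, lintegral_const, measure_univ, one_mul]

lemma fourier_exp_mul_charFun {c : ℝ} (hc : 0 < c) (x : E) :
    𝓕 (fun s => Complex.exp (-c⁻¹ * ‖s‖ ^ 2) * charFun ν ((2 * Real.pi) • s)) x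
      = ((∫ y, gaussianKernel c (x - y) ∂ν : ℝ) : ℂ) := by
  have hre : 0 < ((c⁻¹ : ℝ) : ℂ).re := inv_pos.2 hc
  have hkernel : ∀ y : E,
      𝓕 (fun s => Complex.exp (-c⁻¹ * ‖s‖ ^ 2 + 2 * Real.pi * Complex.I * inner ℝ y s)) x
        = gaussianKernel c (x - y) := by
    intro y
    rw [fourier_gaussian_innerProductSpace' hre, gaussianKernel]
    push_cast
    rw [Complex.ofReal_cpow (by positivity), div_inv_eq_mul, norm_sub_rev]
    push_cast
    congr 2
    field_simp
  have hint : Integrable (fun z : E × E => 𝐞 (-inner ℝ z.1 x) • Complex.exp (-c⁻¹ * ‖z.1‖ ^ 2 +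
      2 * Real.pi * Complex.I * inner ℝ z.2 z.1)) (volume.prod ν) := by
    have hgauss := GaussianFourier.integrable_cexp_neg_mul_sq_norm_add hre 0 (0 : E)
    refine (hgauss.mul_prod (ν := ν) (integrable_const (1 : ℂ))).mono ?_ (ae_of_all _ fun z => ?_)
    · have := Real.continuous_fourierChar
      exact (by fun_prop : Continuous _).aestronglyMeasurable
    · simp [Circle.norm_smul, Complex.norm_exp]
  calc 𝓕 (fun s => Complex.exp (-c⁻¹ * ‖s‖ ^ 2) * charFun ν ((2 * Real.pi) • s)) x
      = ∫ s, ∫ y, 𝐞 (-inner ℝ s x) • Complex.exp (-c⁻¹ * ‖s‖ ^ 2 +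
          2 * Real.pi * Complex.I * inner ℝ y s) ∂ν := by
        rw [Real.fourier_eq]
        refine integral_congr_ae (ae_of_all _ fun s => ?_)
        simp only [Circle.smul_def, integral_smul, charFun_apply, ← integral_const_mul,
          ← Complex.exp_add, inner_smul_right]
        push_cast
        congr! 5
        ring
    _ = ∫ y, (gaussianKernel c (x - y) : ℂ) ∂ν := by
        rw [integral_integral_swap hint]
        simp_rw [← hkernel, Real.fourier_eq]
    _ = ((∫ y, gaussianKernel c (x - y) ∂ν : ℝ) : ℂ) := integral_ofReal

variable {ν}

lemma tendsto_integral_gaussianKernel (h : Integrable (charFun ν)) (x : E) :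
    Tendsto (fun c : ℝ => ((∫ y, gaussianKernel c (x - y) ∂ν : ℝ) : ℂ)) atTop
      (𝓝 (𝓕 (fun s => charFun ν ((2 * Real.pi) • s)) x)) := by
  have hint := (Real.fourierIntegral_convergent_iff x).2
    (h.comp_smul (R := 2 * Real.pi) (by positivity))
  refine (Real.tendsto_integral_cexp_sq_smul hint).congr' ?_
  filter_upwards [eventually_gt_atTop 0] with c hc
  rw [← fourier_exp_mul_charFun ν hc x, Real.fourier_eq]
  simp only [smul_comm (Complex.exp _), smul_eq_mul, Complex.ofReal_inv]

lemma tendsto_integral_gaussianKernel_charFunDensity (h : Integrable (charFun ν)) (x : E) :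
    Tendsto (fun c : ℝ => ∫ y, gaussianKernel c (x - y) ∂ν) atTop (𝓝 (charFunDensity ν x)) :=
  (Complex.continuous_re.tendsto _).comp (tendsto_integral_gaussianKernel h x)

lemma ofReal_charFunDensity (h : Integrable (charFun ν)) (x : E) :
    (charFunDensity ν x : ℂ) = 𝓕 (fun s => charFun ν ((2 * Real.pi) • s)) x :=
  tendsto_nhds_unique ((Complex.continuous_ofReal.tendsto _).comp
    (tendsto_integral_gaussianKernel_charFunDensity h x)) (tendsto_integral_gaussianKernel h x)

lemma charFunDensity_nonneg (h : Integrable (charFun ν)) (x : E) : 0 ≤ charFunDensity ν x := by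
  refine ge_of_tendsto (tendsto_integral_gaussianKernel_charFunDensity h x) ?_
  filter_upwards [eventually_gt_atTop 0] with c hc
  exact integral_nonneg fun y => gaussianKernel_nonneg hc _

lemma lintegral_charFunDensity_le_one (h : Integrable (charFun ν)) :
    ∫⁻ x, ENNReal.ofReal (charFunDensity ν x) ≤ 1 := by
  have hc : ∀ m : ℕ, (0 : ℝ) < m + 1 := fun m => by positivity
  have hlim : ∀ x, ENNReal.ofReal (charFunDensity ν x) = liminf (fun m : ℕ =>
      ENNReal.ofReal (∫ y, gaussianKernel ((m : ℝ) + 1) (x - y) ∂ν)) atTop := fun x =>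
    (((ENNReal.continuous_ofReal.tendsto _).comp
      (tendsto_integral_gaussianKernel_charFunDensity h x)).comp
      (tendsto_atTop_add_const_right atTop 1 tendsto_natCast_atTop_atTop)).liminf_eq.symm
  calc ∫⁻ x, ENNReal.ofReal (charFunDensity ν x)
      ≤ liminf (fun m : ℕ => ∫⁻ x,
          ENNReal.ofReal (∫ y, gaussianKernel ((m : ℝ) + 1) (x - y) ∂ν)) atTop := by
        simp_rw [hlim]
        refine lintegral_liminf_le fun m => (StronglyMeasurable.measurable ?_).ennreal_ofReal
        exact StronglyMeasurable.integral_prod_right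
          (f := fun x y => gaussianKernel ((m : ℝ) + 1) (x - y))
          (by fun_prop : Continuous _).stronglyMeasurable
    _ = 1 := by simp_rw [lintegral_integral_gaussianKernel ν (hc _), liminf_const]

lemma eq_withDensity_charFunDensity (h : Integrable (charFun ν)) :
    ν = volume.withDensity fun x => ENNReal.ofReal (charFunDensity ν x) := by
  have hcont := continuous_charFunDensity h
  have hfin : ∫⁻ x, ENNReal.ofReal (charFunDensity ν x) < ∞ :=
    (lintegral_charFunDensity_le_one h).trans_lt ENNReal.one_lt_top
  have : IsFiniteMeasure (volume.withDensity fun x => ENNReal.ofReal (charFunDensity ν x)) :=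
    isFiniteMeasure_withDensity hfin.ne
  have hint : Integrable (charFunDensity ν) := ⟨hcont.aestronglyMeasurable,
    (hasFiniteIntegral_iff_ofReal (ae_of_all _ (charFunDensity_nonneg h))).2 hfin⟩
  have hinv : 𝓕⁻ (fun x => (charFunDensity ν x : ℂ)) = fun s => charFun ν ((2 * Real.pi) • s) := by
    have hfourier := funext (ofReal_charFunDensity h)
    rw [hfourier]
    exact (continuous_charFun.comp (continuous_const_smul _)).fourierInv_fourier_eq
      (h.comp_smul (by positivity)) (hfourier ▸ hint.ofReal)
  refine Measure.ext_of_charFun (funext fun t => ?_)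
  have hinv_t := congrFun hinv ((2 * Real.pi)⁻¹ • t)
  rw [smul_inv_smul₀ (by positivity), Real.fourierInv_eq'] at hinv_t
  rw [← hinv_t, charFun_apply, integral_withDensity_eq_integral_toReal_smul (by fun_prop)
    (ae_of_all _ fun x => ENNReal.ofReal_lt_top)]
  refine integral_congr_ae (ae_of_all _ fun x => ?_)
  beta_reduce
  rw [ENNReal.toReal_ofReal (charFunDensity_nonneg h x), inner_smul_right,
    mul_inv_cancel_left₀ (by positivity), Complex.real_smul, smul_eq_mul, mul_comm]

end FourierInversion

lemma integrable_one_div_one_add_mul_sq {b : ℝ} (hb : 0 < b) :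
    Integrable (fun s : ℝ => 1 / (1 + b * s ^ 2)) := by
  refine (integrable_inv_one_add_sq.comp_mul_left' (R := √b) (by positivity)).congr
    (ae_of_all _ fun s => ?_)
  simp only [mul_pow, Real.sq_sqrt hb.le, one_div]

lemma integral_one_div_one_add_mul_sq {b : ℝ} (hb : 0 < b) :
    ∫ s : ℝ, 1 / (1 + b * s ^ 2) = Real.pi / √b := by
  have h := Measure.integral_comp_mul_left (fun s : ℝ => (1 + s ^ 2)⁻¹) (√b)
  rw [integral_univ_inv_one_add_sq, abs_of_pos (by positivity), smul_eq_mul] at h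
  simpa only [mul_pow, Real.sq_sqrt hb.le, one_div, div_eq_inv_mul, mul_one] using h

theorem exists_continuous_density_of_norm_charFun_le (ν : Measure ℝ) [IsProbabilityMeasure ν]
    {b : ℝ} (hb : 0 < b) (h : ∀ s, ‖charFun ν s‖ ≤ 1 / (1 + b * s ^ 2)) :
    ∃ p : ℝ → ℝ, Continuous p ∧ (∀ x, 0 ≤ p x) ∧ (∀ x, p x ≤ 1 / (2 * √b)) ∧
      ν = volume.withDensity (fun x => ENNReal.ofReal (p x)) := by
  have hbound := integrable_one_div_one_add_mul_sq hb
  have hint : Integrable (charFun ν) :=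
    hbound.mono' measurable_charFun.aestronglyMeasurable (ae_of_all _ h)
  refine ⟨charFunDensity ν, continuous_charFunDensity hint, charFunDensity_nonneg hint,
    fun x => ?_, eq_withDensity_charFunDensity hint⟩
  calc charFunDensity ν x ≤ (2 * Real.pi)⁻¹ * ∫ s, ‖charFun ν s‖ := by
        simpa using charFunDensity_le_integral_norm_charFun ν x
    _ ≤ (2 * Real.pi)⁻¹ * ∫ s : ℝ, 1 / (1 + b * s ^ 2) := by
        exact mul_le_mul_of_nonneg_left (integral_mono hint.norm hbound h) (by positivity)
    _ = 1 / (2 * √b) := by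
        rw [integral_one_div_one_add_mul_sq hb]
        field_simp

section AreaFormula

lemma encard_inter_preimage_singleton_of_injOn {α β : Type*} {T : α → β} {t : Set α}
    (h : InjOn T t) (y : β) :
    ((t ∩ T ⁻¹' {y}).encard : ℝ≥0∞) = (T '' t).indicator 1 y := by
  by_cases hy : y ∈ T '' t
  · obtain ⟨x, hx, rfl⟩ := hy
    have hfibre : t ∩ T ⁻¹' {T x} = {x} :=
      Subset.antisymm (fun z hz => h hz.1 hx hz.2) (singleton_subset_iff.2 ⟨hx, rfl⟩)
    simp [hfibre, mem_image_of_mem T hx]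
  · have hfibre : t ∩ T ⁻¹' {y} = ∅ :=
      eq_empty_of_forall_notMem fun z hz => hy ⟨z, hz.1, hz.2⟩
    simp [hfibre, indicator_of_notMem hy]

lemma encard_iUnion_eq_tsum {α κ : Type*} [Countable κ] {A : κ → Set α}
    (h : Pairwise (Disjoint on A)) :
    ((⋃ i, A i).encard : ℝ≥0∞) = ∑' i, ((A i).encard : ℝ≥0∞) := by
  let _ : MeasurableSpace α := ⊤
  have hm : ∀ s : Set α, MeasurableSet s := fun _ => MeasurableSpace.measurableSet_top
  simpa only [Measure.count_apply (hm _)] using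
    measure_iUnion (μ := Measure.count) h fun i => hm (A i)

lemma encard_inter_preimage_eq_tsum {α β κ : Type*} [Countable κ] {T : α → β} {s : Set α}
    {t : κ → Set α} (hts : ⋃ i, t i ⊆ s) (hdisj : Pairwise (Disjoint on t))
    (hinj : ∀ i, InjOn T (t i)) {y : β} (hy : y ∉ T '' (s \ ⋃ i, t i)) :
    ((s ∩ T ⁻¹' {y}).encard : ℝ≥0∞) = ∑' i, (T '' t i).indicator 1 y := by
  have hfibre : s ∩ T ⁻¹' {y} = ⋃ i, (t i ∩ T ⁻¹' {y}) := by
    rw [← iUnion_inter]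
    refine Subset.antisymm (fun x hx => ⟨?_, hx.2⟩) (inter_subset_inter_left _ hts)
    by_contra hxt
    exact hy ⟨x, ⟨hx.1, hxt⟩, hx.2⟩
  rw [hfibre, encard_iUnion_eq_tsum fun i j hij =>
    (hdisj hij).mono inter_subset_left inter_subset_left]
  exact tsum_congr fun i => encard_inter_preimage_singleton_of_injOn (hinj i) y

variable {E : Type*} [NormedAddCommGroup E] [NormedSpace ℝ E] [FiniteDimensional ℝ E]

lemma exists_injOn_of_approximatesLinearOn {A : E →L[ℝ] E} (hA : A.det ≠ 0) :
    ∃ r : NNReal, r ≠ 0 ∧ ∀ T u, ApproximatesLinearOn T A u r → InjOn T u := by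
  set B := A.toContinuousLinearEquivOfDetNeZero hA
  have hAB : A = (B : E →L[ℝ] E) := by simp [B]
  obtain hE | hB := B.subsingleton_or_nnnorm_symm_pos
  · exact ⟨1, one_ne_zero, fun T u h => (hAB ▸ h).injOn (Or.inl hE)⟩
  · obtain ⟨r, hr, hrB⟩ := exists_between (inv_pos.2 hB)
    exact ⟨r, hr.ne', fun T u h => (hAB ▸ h).injOn (Or.inr hrB)⟩

variable [MeasurableSpace E] [BorelSpace E] {T : E → E} {T' : E → E →L[ℝ] E} {s : Set E}

lemma exists_partition_injOn_of_det_ne_zero (hs : MeasurableSet s)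
    (hT : ∀ x ∈ s, HasFDerivWithinAt T (T' x) s x) (hdet : ∀ x ∈ s, (T' x).det ≠ 0) :
    ∃ t : ℕ → Set E, (∀ i, MeasurableSet (t i)) ∧ Pairwise (Disjoint on t) ∧
      ⋃ i, t i = s ∧ ∀ i, InjOn T (t i) := by
  have hradius : ∀ A : E →L[ℝ] E, ∃ r : NNReal, r ≠ 0 ∧
      (A.det ≠ 0 → ∀ u, ApproximatesLinearOn T A u r → InjOn T u) := by
    intro A
    by_cases hA : A.det = 0
    · exact ⟨1, one_ne_zero, fun h => absurd hA h⟩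
    · obtain ⟨r, hr, hinj⟩ := exists_injOn_of_approximatesLinearOn hA
      exact ⟨r, hr, fun _ => hinj T⟩
  choose r hr hinj using hradius
  obtain ⟨t, A, hdisj, hmeas, hcover, happrox, hA⟩ :=
    exists_partition_approximatesLinearOn_of_hasFDerivWithinAt T s T' hT r hr
  refine ⟨fun i => s ∩ t i, fun i => hs.inter (hmeas i), fun i j hij =>
    (hdisj hij).mono inter_subset_right inter_subset_right, ?_, fun i => ?_⟩
  · rw [← inter_iUnion, inter_eq_left.2 hcover]
  · obtain rfl | hne := s.eq_empty_or_nonempty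
    · simp
    · obtain ⟨y, hy, hAy⟩ := hA hne i
      exact hinj (A i) (hAy ▸ hdet y hy) _ (happrox i)

variable (μ : Measure E) [μ.IsAddHaarMeasure]

/-- A form of Sard's lemma in equal dimensions. -/
lemma exists_subset_det_ne_zero_image_sdiff_null (hs : MeasurableSet s)
    (hT : ∀ x ∈ s, HasFDerivWithinAt T (T' x) s x) :
    ∃ t ⊆ s, MeasurableSet t ∧ (∀ x ∈ t, (T' x).det ≠ 0) ∧ μ (T '' (s \ t)) = 0 ∧
      ∀ᵐ x ∂μ.restrict (s \ t), (T' x).det = 0 := by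
  have hregular : NullMeasurableSet ({x | (T' x).det ≠ 0} ∩ s) μ :=
    (nullMeasurableSet_restrict hs.nullMeasurableSet).1 <|
      (ContinuousLinearMap.continuous_det.measurable.comp_aemeasurable
        (aemeasurable_fderivWithin μ hs hT)).nullMeasurable (measurableSet_singleton 0).compl
  obtain ⟨t, hts, ht, hae⟩ := hregular.exists_measurable_subset_ae_eq
  have hnull : μ (({x | (T' x).det ≠ 0} ∩ s) \ t) = 0 := ae_le_set.1 hae.symm.le
  have hsdiff : s \ t ⊆ {x ∈ s | (T' x).det = 0} ∪ (({x | (T' x).det ≠ 0} ∩ s) \ t) := by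
    intro x hx
    by_cases h : (T' x).det = 0
    · exact Or.inl ⟨hx.1, h⟩
    · exact Or.inr ⟨⟨h, hx.1⟩, hx.2⟩
  refine ⟨t, hts.trans inter_subset_right, ht, fun x hx => (hts hx).1, ?_, ?_⟩
  · refine measure_mono_null ((image_mono hsdiff).trans (image_union ..).subset)
      (measure_union_null ?_ ?_)
    · exact addHaar_image_eq_zero_of_det_fderivWithin_eq_zero μ
        (fun x hx => (hT x hx.1).mono fun _ h => h.1) fun x hx => hx.2
    · exact addHaar_image_eq_zero_of_differentiableOn_of_addHaar_eq_zero μ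
        (fun x hx => ((hT x hx.1.2).mono fun _ h => h.1.2).differentiableWithinAt) hnull
  · rw [ae_restrict_iff' (hs.diff ht)]
    filter_upwards [measure_eq_zero_iff_ae_notMem.1 hnull] with x hx hxst
    exact (hsdiff hxst).elim (fun h => h.2) fun h => absurd h hx

theorem area_formula (hs : MeasurableSet s) (hT : ∀ x ∈ s, HasFDerivWithinAt T (T' x) s x) :
    AEMeasurable (fun y => ((s ∩ T ⁻¹' {y}).encard : ℝ≥0∞)) μ ∧
      ∀ W : E → ℝ≥0∞, Measurable W →
        ∫⁻ y, ((s ∩ T ⁻¹' {y}).encard : ℝ≥0∞) * W y ∂μ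
          = ∫⁻ x in s, ENNReal.ofReal |(T' x).det| * W (T x) ∂μ := by
  obtain ⟨s₁, hs₁s, hs₁, hdet, hnull, hzero⟩ := exists_subset_det_ne_zero_image_sdiff_null μ hs hT
  obtain ⟨t, ht, hdisj, rfl, hinj⟩ := exists_partition_injOn_of_det_ne_zero hs₁
    (fun x hx => (hT x (hs₁s hx)).mono hs₁s) hdet
  have hderiv : ∀ i, ∀ x ∈ t i, HasFDerivWithinAt T (T' x) (t i) x := fun i x hx =>
    have hts := (subset_iUnion t i).trans hs₁s
    (hT x (hts hx)).mono hts
  have himage : ∀ i, MeasurableSet (T '' t i) := fun i =>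
    measurable_image_of_fderivWithin (ht i) (hderiv i) (hinj i)
  have hcount : (fun y => ((s ∩ T ⁻¹' {y}).encard : ℝ≥0∞))
      =ᵐ[μ] fun y => ∑' i, (T '' t i).indicator 1 y :=
    (measure_eq_zero_iff_ae_notMem.1 hnull).mono fun y hy =>
      encard_inter_preimage_eq_tsum hs₁s hdisj hinj hy
  refine ⟨(Measurable.tsum fun i => measurable_one.indicator (himage i)).aemeasurable.congr
    hcount.symm, fun W hW => ?_⟩
  calc ∫⁻ y, ((s ∩ T ⁻¹' {y}).encard : ℝ≥0∞) * W y ∂μ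
      = ∫⁻ y, ∑' i, (T '' t i).indicator W y ∂μ := by
        refine lintegral_congr_ae (hcount.mono fun y hy => ?_)
        beta_reduce at hy ⊢
        rw [hy, ← ENNReal.tsum_mul_right]
        simp only [← indicator_mul_left, Pi.one_apply, one_mul]
    _ = ∑' i, ∫⁻ x in t i, ENNReal.ofReal |(T' x).det| * W (T x) ∂μ := by
        rw [lintegral_tsum fun i => (hW.indicator (himage i)).aemeasurable]
        simp_rw [lintegral_indicator (himage _),
          lintegral_image_eq_lintegral_abs_det_fderiv_mul μ (ht _) (hderiv _) (hinj _) W]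
    _ = ∫⁻ x in ⋃ i, t i, ENNReal.ofReal |(T' x).det| * W (T x) ∂μ :=
        (lintegral_iUnion ht hdisj _).symm
    _ = ∫⁻ x in s, ENNReal.ofReal |(T' x).det| * W (T x) ∂μ := by
        have hcritical : ∫⁻ x in s \ ⋃ i, t i, ENNReal.ofReal |(T' x).det| * W (T x) ∂μ = 0 :=
          lintegral_eq_zero_of_ae_eq_zero (hzero.mono fun x hx => by simp [hx])
        rw [← lintegral_inter_add_sdiff _ s hs₁, inter_eq_self_of_subset_right hs₁s, hcritical,
          add_zero]

end AreaFormula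

section ProductMeasure

variable {ι : Type*} [DecidableEq ι] {X : ι → Type*}

lemma prod_update_apply (p : ∀ i, X i → ℝ≥0∞) {s : Finset ι} {k : ι} (hk : k ∉ s) (x : ∀ i, X i)
    (t : X k) : ∏ i ∈ s, p i (update x k t i) = ∏ i ∈ s, p i (x i) :=
  Finset.prod_congr rfl fun i hi => by rw [update_of_ne fun h : i = k => hk (h ▸ hi)]

variable [∀ i, MeasurableSpace (X i)] {μ : ∀ i, Measure (X i)} [∀ i, SigmaFinite (μ i)]
  {p : ∀ i, X i → ℝ≥0∞}

lemma lmarginal_prod_apply (hp : ∀ i, Measurable (p i)) (s : Finset ι) :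
    ∫⋯∫⁻_s, (fun x => ∏ i ∈ s, p i (x i)) ∂μ = fun _ => ∏ i ∈ s, ∫⁻ t, p i t ∂μ i := by
  induction s using Finset.induction_on with
  | empty => simp
  | insert k s hk ih =>
    have hinner : ∀ x : ∀ i, X i, ∫⁻ t, ∏ i ∈ insert k s, p i (update x k t i) ∂μ k
        = (∫⁻ t, p k t ∂μ k) * ∏ i ∈ s, p i (x i) := fun x => by
      simp_rw [Finset.prod_insert hk, update_self, prod_update_apply p hk]
      exact lintegral_mul_const _ (hp k)
    rw [lmarginal_insert' _ (by fun_prop) hk]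
    simp_rw [hinner]
    ext x
    rw [Finset.prod_insert hk, ← congrFun ih x]
    exact lintegral_const_mul _ (by fun_prop)

variable [Fintype ι]

omit [DecidableEq ι] in
lemma lintegral_pi_prod_apply (hp : ∀ i, Measurable (p i)) :
    ∫⁻ x, ∏ i, p i (x i) ∂Measure.pi μ = ∏ i, ∫⁻ t, p i t ∂μ i := by
  classical
  rcases isEmpty_or_nonempty (∀ i, X i) with h | ⟨⟨x⟩⟩
  · obtain ⟨i, hi⟩ := isEmpty_pi.1 h
    rw [lintegral_of_isEmpty, Finset.prod_eq_zero (Finset.mem_univ i) (lintegral_of_isEmpty _ _)]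
  · rw [lintegral_eq_lmarginal_univ x, lmarginal_prod_apply hp]

omit [DecidableEq ι] in
lemma pi_withDensity_eq (hp : ∀ i, Measurable (p i)) [∀ i, SigmaFinite ((μ i).withDensity (p i))] :
    Measure.pi (fun i => (μ i).withDensity (p i))
      = (Measure.pi μ).withDensity fun x => ∏ i, p i (x i) := by
  refine Measure.pi_eq fun s hs => ?_
  rw [withDensity_apply _ (MeasurableSet.univ_pi hs), Measure.restrict_pi_pi,
    lintegral_pi_prod_apply hp]
  exact Finset.prod_congr rfl fun i _ => (withDensity_apply _ (hs i)).symm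

lemma lintegral_pi_eq_lintegral_lintegral_update (k : ι) [IsProbabilityMeasure (μ k)]
    {F : (∀ i, X i) → ℝ≥0∞} (hF : Measurable F) :
    ∫⁻ x, F x ∂Measure.pi μ = ∫⁻ x, (∫⁻ t, F (update x k t) ∂μ k) ∂Measure.pi μ := by
  rw [← lmarginal_singleton F k]
  refine lintegral_eq_of_lmarginal_eq {k} hF (hF.lmarginal μ) ?_
  conv_rhs => rw [lmarginal_singleton]
  ext x
  simp only [lmarginal_update_of_mem μ (Finset.mem_singleton_self k), lintegral_const, measure_univ,
    mul_one]

lemma lintegral_prod_erase_mul (k : ι) (hp : ∀ i, Measurable (p i))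
    [∀ i, SigmaFinite ((μ i).withDensity (p i))] (hpk : ∫⁻ t, p k t ∂μ k = 1)
    {F : (∀ i, X i) → ℝ≥0∞} (hF : Measurable F) :
    ∫⁻ x, (∏ i ∈ Finset.univ.erase k, p i (x i)) * F x ∂Measure.pi μ
      = ∫⁻ t, ∫⁻ x, F (update x k t) ∂Measure.pi (fun i => (μ i).withDensity (p i)) ∂μ k := by
  have hmarginal : Measurable (∫⋯∫⁻_{k}, F ∂μ) := hF.lmarginal μ
  calc ∫⁻ x, (∏ i ∈ Finset.univ.erase k, p i (x i)) * F x ∂Measure.pi μ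
      = ∫⁻ x, (∏ i, p i (x i)) * (∫⋯∫⁻_{k}, F ∂μ) x ∂Measure.pi μ := by
        refine lintegral_eq_of_lmarginal_eq {k} (by fun_prop) (by fun_prop) ?_
        simp_rw [lmarginal_singleton _ k, ← Finset.mul_prod_erase _ _ (Finset.mem_univ k),
          update_self, prod_update_apply p (Finset.notMem_erase k _), update_idem]
        ext x
        rw [lintegral_const_mul _ (by fun_prop), lintegral_mul_const _ (by fun_prop),
          lintegral_mul_const _ (hp k), hpk, one_mul]
    _ = ∫⁻ x, ∫⁻ t, (∏ i, p i (x i)) * F (update x k t) ∂μ k ∂Measure.pi μ := by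
        refine lintegral_congr fun x => ?_
        rw [lmarginal_singleton, lintegral_const_mul _ (by fun_prop)]
    _ = ∫⁻ t, ∫⁻ x, (∏ i, p i (x i)) * F (update x k t) ∂Measure.pi μ ∂μ k :=
        lintegral_lintegral_swap (by fun_prop)
    _ = ∫⁻ t, ∫⁻ x, F (update x k t) ∂Measure.pi (fun i => (μ i).withDensity (p i)) ∂μ k := by
        refine lintegral_congr fun t => ?_
        rw [pi_withDensity_eq hp]
        exact (lintegral_withDensity_eq_lintegral_mul _ (by fun_prop) (by fun_prop)).symm

end ProductMeasure

lemma lintegral_eq_lintegral_density_mul {ν : Measure ℝ} {p : ℝ → ℝ} (hp : Measurable p)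
    (hν : ν = volume.withDensity fun x => ENNReal.ofReal (p x)) {G : ℝ → ℝ≥0∞}
    (hG : Measurable G) : ∫⁻ t, G t ∂ν = ∫⁻ t, ENNReal.ofReal (p t) * G t := by
  rw [hν]
  exact lintegral_withDensity_eq_lintegral_mul _ hp.ennreal_ofReal hG

lemma lintegral_comp_mul_add {c : ℝ} (hc : c ≠ 0) (r : ℝ) {G : ℝ → ℝ≥0∞} (hG : Measurable G) :
    ∫⁻ t, G (c * t + r) = ENNReal.ofReal |c|⁻¹ * ∫⁻ y, G y := by
  calc ∫⁻ t, G (c * t + r) = ∫⁻ y, G (y + r) ∂(Measure.map (c * ·) volume) :=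
        (lintegral_map (hG.comp (measurable_id.add_const r)) (measurable_const_mul c)).symm
    _ = ENNReal.ofReal |c|⁻¹ * ∫⁻ y, G y := by
        rw [Real.map_volume_mul_left hc, lintegral_smul_measure, lintegral_add_right_eq_self,
          abs_inv, smul_eq_mul]

section Semicontinuity

variable {Y : Type*} [TopologicalSpace Y]

lemma lowerSemicontinuous_lintegral [FirstCountableTopology Y] {α : Type*} [MeasurableSpace α]
    {μ : Measure α} {G : Y → α → ℝ≥0∞} (hmeas : ∀ y, Measurable (G y))
    (hcont : ∀ a, Continuous fun y => G y a) : LowerSemicontinuous fun y => ∫⁻ a, G y a ∂μ := by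
  refine lowerSemicontinuous_iff_le_liminf.2 fun y => ?_
  calc ∫⁻ a, G y a ∂μ = ∫⁻ a, liminf (fun z => G z a) (𝓝 y) ∂μ :=
        lintegral_congr fun a => ((hcont a).tendsto y).liminf_eq.symm
    _ ≤ liminf (fun z => ∫⁻ a, G z a ∂μ) (𝓝 y) := lintegral_liminf_le hmeas

lemma le_of_ae_le_of_lowerSemicontinuous [MeasurableSpace Y] {μ : Measure Y} [μ.IsOpenPosMeasure]
    {γ : Type*} [LinearOrder γ] {f : Y → γ} (hf : LowerSemicontinuous f) {M : γ}
    (h : ∀ᵐ y ∂μ, f y ≤ M) (y : Y) : f y ≤ M := by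
  have hnull : μ (f ⁻¹' Ioi M) = 0 := by
    simp only [ae_iff, not_le] at h
    exact h
  have hempty := (hf.isOpen_preimage M).eq_empty_of_measure_zero hnull
  exact not_lt.1 fun hy => (hempty ▸ (hy : y ∈ f ⁻¹' Ioi M) : y ∈ (∅ : Set Y))

end Semicontinuity

section Slicing

variable {ι : Type*} [Fintype ι]

/-- The value of the `k`-th coordinate that puts `v` on the hyperplane `∑ j, v j * c j = y`. -/
noncomputable def slicePoint (c : ι → ℝ) (k : ι) (y : ℝ) (v : ι → ℝ) : ℝ :=
  v k + (y - ∑ j, v j * c j) / c k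

@[fun_prop]
lemma continuous_slicePoint (c : ι → ℝ) (k : ι) :
    Continuous (fun z : ℝ × (ι → ℝ) => slicePoint c k z.1 z.2) := by
  unfold slicePoint; fun_prop

@[fun_prop]
lemma measurable_slicePoint (c : ι → ℝ) (k : ι) :
    Measurable (fun z : ℝ × (ι → ℝ) => slicePoint c k z.1 z.2) :=
  (continuous_slicePoint c k).measurable

variable [DecidableEq ι] {c : ι → ℝ} {k : ι}

lemma sum_update_mul (c : ι → ℝ) (k : ι) (t : ℝ) (v : ι → ℝ) :
    ∑ j, update v k t j * c j = c k * t + (∑ j, v j * c j - v k * c k) := by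
  have hrest : ∑ j ∈ Finset.univ.erase k, update v k t j * c j
      = ∑ j ∈ Finset.univ.erase k, v j * c j :=
    Finset.sum_congr rfl fun j hj => by rw [update_of_ne (Finset.ne_of_mem_erase hj)]
  rw [← Finset.add_sum_erase Finset.univ _ (Finset.mem_univ k),
    ← Finset.add_sum_erase Finset.univ (fun j => v j * c j) (Finset.mem_univ k), hrest,
    update_self]
  ring

lemma sum_update_slicePoint (hc : c k ≠ 0) (y : ℝ) (v : ι → ℝ) :
    ∑ j, update v k (slicePoint c k y v) j * c j = y := by
  rw [sum_update_mul, slicePoint]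
  field_simp
  ring

lemma slicePoint_sum_update (hc : c k ≠ 0) (t : ℝ) (v : ι → ℝ) :
    slicePoint c k (∑ j, update v k t j * c j) v = t := by
  rw [sum_update_mul, slicePoint]
  field_simp
  ring

lemma slicePoint_update (hc : c k ≠ 0) (t y : ℝ) (v : ι → ℝ) :
    slicePoint c k y (update v k t) = slicePoint c k y v := by
  rw [slicePoint, sum_update_mul, slicePoint, update_self]
  field_simp
  ring

/-- The density at `y` of the image of `F · ⨂ ν` under `v ↦ ∑ j, v j * c j`, computed by solving
for the `k`-th coordinate; `p` is the density of `ν k`. -/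
noncomputable def sliceIntegral (ν : ι → Measure ℝ) (p : ℝ → ℝ) (c : ι → ℝ) (k : ι)
    (F : (ι → ℝ) → ℝ≥0∞) (y : ℝ) : ℝ≥0∞ :=
  ENNReal.ofReal |c k|⁻¹ * ∫⁻ v, F (update v k (slicePoint c k y v)) *
    ENNReal.ofReal (p (slicePoint c k y v)) ∂Measure.pi ν

variable {ν : ι → Measure ℝ} {p : ℝ → ℝ}

lemma lowerSemicontinuous_sliceIntegral (hp : Continuous p) {F : (ι → ℝ) → ℝ≥0∞}
    (hF : Continuous F) (hFtop : ∀ v, F v ≠ ∞) : LowerSemicontinuous (sliceIntegral ν p c k F) := by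
  have hconst : sliceIntegral ν p c k F = fun y => ∫⁻ v, ENNReal.ofReal |c k|⁻¹ *
      (F (update v k (slicePoint c k y v)) * ENNReal.ofReal (p (slicePoint c k y v)))
        ∂Measure.pi ν :=
    funext fun y => (lintegral_const_mul' _ _ ENNReal.ofReal_ne_top).symm
  rw [hconst]
  refine lowerSemicontinuous_lintegral (fun y => by fun_prop) fun v => ?_
  refine (ENNReal.continuous_const_mul ENNReal.ofReal_ne_top).comp ?_
  refine continuous_iff_continuousAt.2 fun y => ENNReal.Tendsto.mul ?_
    (Or.inr ENNReal.ofReal_ne_top) ?_ (Or.inr (hFtop _))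
  · exact (by fun_prop : Continuous _).continuousAt
  · exact (ENNReal.continuous_ofReal.comp (by fun_prop)).continuousAt

variable [∀ i, IsProbabilityMeasure (ν i)]

@[fun_prop]
lemma measurable_sliceIntegral (hp : Measurable p) {F : (ι → ℝ) → ℝ≥0∞} (hF : Measurable F) :
    Measurable (sliceIntegral ν p c k F) := by
  unfold sliceIntegral
  fun_prop

lemma lintegral_pi_eq_lintegral_sliceIntegral (hp : Measurable p)
    (hν : ν k = volume.withDensity fun x => ENNReal.ofReal (p x)) (hc : c k ≠ 0)
    {H : ℝ → (ι → ℝ) → ℝ≥0∞} (hH : Measurable (uncurry H)) :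
    ∫⁻ v, H (∑ j, v j * c j) v ∂Measure.pi ν = ∫⁻ y, sliceIntegral ν p c k (H y) y := by
  have hslice : ∀ v : ι → ℝ, ∫⁻ t, H (∑ j, update v k t j * c j) (update v k t) ∂ν k
      = ENNReal.ofReal |c k|⁻¹ * ∫⁻ y, H y (update v k (slicePoint c k y v)) *
          ENNReal.ofReal (p (slicePoint c k y v)) := by
    intro v
    rw [lintegral_eq_lintegral_density_mul hp hν (by fun_prop),
      ← lintegral_comp_mul_add hc (∑ j, v j * c j - v k * c k) (by fun_prop)]
    refine lintegral_congr fun t => ?_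
    rw [← sum_update_mul, slicePoint_sum_update hc, mul_comm]
  rw [lintegral_pi_eq_lintegral_lintegral_update k (by fun_prop)]
  simp_rw [hslice, sliceIntegral]
  rw [lintegral_const_mul _ (by fun_prop), lintegral_const_mul _ (by fun_prop),
    lintegral_lintegral_swap (by fun_prop)]

lemma sliceIntegral_le_of_forall_lintegral_le (hp : Continuous p)
    (hν : ν k = volume.withDensity fun x => ENNReal.ofReal (p x)) (hc : c k ≠ 0)
    {F : (ι → ℝ) → ℝ≥0∞} (hF : Continuous F) (hFtop : ∀ v, F v ≠ ∞) {M : ℝ≥0∞}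
    (hM : ∀ B : Set ℝ, MeasurableSet B →
      ∫⁻ v, F v * B.indicator 1 (∑ j, v j * c j) ∂Measure.pi ν ≤ M * volume B)
    (y : ℝ) : sliceIntegral ν p c k F y ≤ M := by
  refine le_of_ae_le_of_lowerSemicontinuous (μ := volume)
    (lowerSemicontinuous_sliceIntegral hp hF hFtop)
    (ae_le_of_forall_setLIntegral_le_of_sigmaFinite (by fun_prop) fun B hB _ => ?_) y
  calc ∫⁻ y in B, sliceIntegral ν p c k F y
      = ∫⁻ y, sliceIntegral ν p c k (fun v => F v * B.indicator 1 y) y := by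
        rw [← lintegral_indicator hB]
        refine lintegral_congr fun y => ?_
        by_cases hy : y ∈ B <;> simp [hy, sliceIntegral]
    _ = ∫⁻ v, F v * B.indicator 1 (∑ j, v j * c j) ∂Measure.pi ν :=
        (lintegral_pi_eq_lintegral_sliceIntegral (by fun_prop) hν hc
          (H := fun y v => F v * B.indicator 1 y) <|
          (hF.measurable.comp measurable_snd).mul
            ((measurable_one.indicator hB).comp measurable_fst)).symm
    _ ≤ ∫⁻ _ in B, M := by
        rw [setLIntegral_const]
        exact hM B hB

end Slicing

lemma one_add_sum_le_prod_one_add {ι : Type*} {x : ι → ℝ} {s : Finset ι} (hx : ∀ i ∈ s, 0 ≤ x i) :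
    1 + ∑ i ∈ s, x i ≤ ∏ i ∈ s, (1 + x i) := by
  induction s using Finset.cons_induction with
  | empty => simp
  | cons k s hk ih =>
    obtain ⟨hxk, hxs⟩ := Finset.forall_mem_cons hk _ |>.1 hx
    rw [Finset.sum_cons, Finset.prod_cons]
    nlinarith [ih hxs, mul_nonneg hxk (Finset.sum_nonneg hxs)]

section Expectation

variable {Ω : Type*} [MeasurableSpace Ω] {μ : Measure Ω} [IsProbabilityMeasure μ]

lemma lintegral_ofReal_abs_le_sqrt_integral_sq {Y : Ω → ℝ} (hY : MemLp Y 2 μ) :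
    ∫⁻ ω, ENNReal.ofReal |Y ω| ∂μ ≤ ENNReal.ofReal √(∫ ω, Y ω ^ 2 ∂μ) := by
  have hvar := variance_nonneg |Y| μ
  rw [variance_eq_sub hY.abs] at hvar
  simp only [Pi.abs_apply, Pi.pow_apply, sq_abs] at hvar
  rw [← ofReal_integral_eq_lintegral_ofReal (hY.integrable one_le_two).abs
    (ae_of_all _ fun ω => abs_nonneg _)]
  exact ENNReal.ofReal_le_ofReal (Real.le_sqrt_of_sq_le (sub_nonneg.1 hvar))

lemma lintegral_mul_indicator_add_le_of_indepFun {T : Ω → ℝ≥0∞} {U V : Ω → ℝ} (hT : Measurable T)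
    (hU : Measurable U) (hV : Measurable V) (hind : IndepFun (fun ω => (T ω, U ω)) V μ) {M : ℝ≥0∞}
    (hM : μ.map V ≤ M • volume) {B : Set ℝ} (hB : MeasurableSet B) :
    ∫⁻ ω, T ω * B.indicator 1 (U ω + V ω) ∂μ ≤ (∫⁻ ω, T ω ∂μ) * (M * volume B) := by
  have : Measurable (B.indicator (1 : ℝ → ℝ≥0∞)) := measurable_one.indicator hB
  have hslice : ∀ u : ℝ, ∫⁻ w, B.indicator 1 (u + w) ∂(μ.map V) ≤ M * volume B := fun u => by
    calc ∫⁻ w, B.indicator 1 (u + w) ∂(μ.map V)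
        ≤ ∫⁻ w, B.indicator 1 (u + w) ∂(M • volume) := lintegral_mono' hM le_rfl
      _ = M * volume B := by
        rw [lintegral_smul_measure, lintegral_add_left_eq_self fun w => B.indicator 1 w,
          lintegral_indicator_one hB, smul_eq_mul]
  calc ∫⁻ ω, T ω * B.indicator 1 (U ω + V ω) ∂μ
      = ∫⁻ z, z.1.1 * B.indicator 1 (z.1.2 + z.2) ∂(μ.map fun ω => ((T ω, U ω), V ω)) :=
        (lintegral_map (f := fun z : (ℝ≥0∞ × ℝ) × ℝ => z.1.1 * B.indicator 1 (z.1.2 + z.2))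
          (by fun_prop) ((hT.prodMk hU).prodMk hV)).symm
    _ = ∫⁻ z, ∫⁻ w, z.1 * B.indicator 1 (z.2 + w) ∂(μ.map V) ∂(μ.map fun ω => (T ω, U ω)) := by
        rw [hind.map_prod_eq_prod_map_map (by fun_prop) (by fun_prop),
          lintegral_prod _ (by fun_prop)]
    _ ≤ ∫⁻ z, z.1 * (M * volume B) ∂(μ.map fun ω => (T ω, U ω)) := by
        refine lintegral_mono fun z => ?_
        rw [lintegral_const_mul _ (by fun_prop)]
        gcongr
        exact hslice z.2
    _ = (∫⁻ ω, T ω ∂μ) * (M * volume B) := by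
        rw [lintegral_map (by fun_prop) (by fun_prop), lintegral_mul_const _ hT]

end Expectation

section LinearForms

variable {Ω ι : Type*} [MeasurableSpace Ω] {μ : Measure Ω}

lemma iIndepFun_mul_const {X : ι → Ω → ℝ} (hX : iIndepFun X μ) (c : ι → ℝ) :
    iIndepFun (fun i ω => X i ω * c i) μ :=
  hX.comp (fun i t => t * c i) fun i => by fun_prop

variable {X : ι → Ω → ℝ} (hX : iIndepFun X μ) (hm : ∀ i, Measurable (X i))

include hX hm

lemma norm_charFun_map_sum_mul_le {b : ℝ} (hb : 0 ≤ b)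
    (h : ∀ i s, ‖charFun (μ.map (X i)) s‖ ≤ 1 / (1 + b * s ^ 2)) (c : ι → ℝ) (A : Finset ι)
    (s : ℝ) :
    ‖charFun (μ.map fun ω => ∑ j ∈ A, X j ω * c j) s‖
      ≤ 1 / (1 + (b * ∑ j ∈ A, c j ^ 2) * s ^ 2) := by
  have hfactor : charFun (μ.map fun ω => ∑ j ∈ A, X j ω * c j) s
      = ∏ j ∈ A, charFun (μ.map (X j)) (c j * s) := by
    have hprod := iIndepFun.charFun_map_fun_finsetSum_eq_prod (s := A)
      (X := fun j ω => X j ω * c j) (fun j _ => by fun_prop)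
      ((iIndepFun_mul_const hX c).restrict A)
    rw [hprod, Finset.prod_apply]
    refine Finset.prod_congr rfl fun j _ => ?_
    rw [← charFun_map_mul, Measure.map_map (by fun_prop) (hm j)]
    simp only [comp_def, mul_comm]
  calc ‖charFun (μ.map fun ω => ∑ j ∈ A, X j ω * c j) s‖
      = ∏ j ∈ A, ‖charFun (μ.map (X j)) (c j * s)‖ := by rw [hfactor, norm_prod]
    _ ≤ ∏ j ∈ A, 1 / (1 + b * (c j * s) ^ 2) :=
        Finset.prod_le_prod (fun j _ => norm_nonneg _) fun j _ => h j _
    _ = 1 / ∏ j ∈ A, (1 + b * (c j * s) ^ 2) := by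
        rw [Finset.prod_div_distrib, Finset.prod_const_one]
    _ ≤ 1 / (1 + ∑ j ∈ A, b * (c j * s) ^ 2) := by
        gcongr
        exact one_add_sum_le_prod_one_add fun j _ => by positivity
    _ = 1 / (1 + (b * ∑ j ∈ A, c j ^ 2) * s ^ 2) := by
        simp only [mul_pow, Finset.mul_sum, Finset.sum_mul, mul_assoc]

variable [IsProbabilityMeasure μ]

lemma map_sum_mul_le_smul_volume {b : ℝ} (hb : 0 < b)
    (h : ∀ i s, ‖charFun (μ.map (X i)) s‖ ≤ 1 / (1 + b * s ^ 2)) {c : ι → ℝ} {A : Finset ι}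
    (hc : 0 < ∑ j ∈ A, c j ^ 2) :
    μ.map (fun ω => ∑ j ∈ A, X j ω * c j)
      ≤ ENNReal.ofReal (1 / (2 * √(b * ∑ j ∈ A, c j ^ 2))) • volume := by
  have hmeas : Measurable fun ω => ∑ j ∈ A, X j ω * c j := by fun_prop
  have := Measure.isProbabilityMeasure_map (μ := μ) hmeas.aemeasurable
  obtain ⟨p, -, -, hp, hmap⟩ := exists_continuous_density_of_norm_charFun_le _ (mul_pos hb hc)
    (norm_charFun_map_sum_mul_le hX hm hb.le h c A)
  rw [hmap, ← withDensity_const]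
  exact withDensity_mono (ae_of_all _ fun x => ENNReal.ofReal_le_ofReal (hp x))

lemma integral_sum_mul_sq (hmem : ∀ i, MemLp (X i) 2 μ) (h0 : ∀ i, ∫ ω, X i ω ∂μ = 0)
    (h2 : ∀ i, ∫ ω, X i ω ^ 2 ∂μ = 1) (c : ι → ℝ) (A : Finset ι) :
    ∫ ω, (∑ j ∈ A, X j ω * c j) ^ 2 ∂μ = ∑ j ∈ A, c j ^ 2 := by
  have hcenter : ∫ ω, ∑ j ∈ A, X j ω * c j ∂μ = 0 := by
    rw [integral_finsetSum _ fun j _ => ((hmem j).mul_const (c j)).integrable one_le_two]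
    simp only [integral_mul_const, h0, zero_mul, Finset.sum_const_zero]
  have hvar : ∀ j, Var[fun ω => X j ω * c j; μ] = c j ^ 2 := fun j => by
    rw [variance_mul_const, variance_of_integral_eq_zero (hm j).aemeasurable (h0 j), h2, one_mul]
  rw [← variance_of_integral_eq_zero (by fun_prop) hcenter]
  have hsum := IndepFun.variance_sum (μ := μ) (X := fun j ω => X j ω * c j) (s := A)
    (fun j _ => (hmem j).mul_const (c j))
    fun i _ j _ hij => (iIndepFun_mul_const hX c).indepFun hij
  simp only [hvar] at hsum
  rw [← hsum]
  congr
  ext ω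
  simp

/-- `∑ j ∈ A, X j * c j` is independent of the part of `∑ j, X j * g j` outside `A`, which has a
bounded density. -/
lemma lintegral_abs_sum_mul_indicator_le [Fintype ι] [DecidableEq ι] {b : ℝ} (hb : 0 < b)
    (h : ∀ i s, ‖charFun (μ.map (X i)) s‖ ≤ 1 / (1 + b * s ^ 2)) (hmem : ∀ i, MemLp (X i) 2 μ)
    (h0 : ∀ i, ∫ ω, X i ω ∂μ = 0) (h2 : ∀ i, ∫ ω, X i ω ^ 2 ∂μ = 1) {A : Finset ι} (c : ι → ℝ)
    {g : ι → ℝ} (hg : 0 < ∑ j ∈ Aᶜ, g j ^ 2) {B : Set ℝ} (hB : MeasurableSet B) :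
    ∫⁻ ω, ENNReal.ofReal |∑ j ∈ A, X j ω * c j| * B.indicator 1 (∑ j, X j ω * g j) ∂μ
      ≤ ENNReal.ofReal (√(∑ j ∈ A, c j ^ 2) * (1 / (2 * √(b * ∑ j ∈ Aᶜ, g j ^ 2)))) * volume B := by
  have hind : IndepFun
      (fun ω => (ENNReal.ofReal |∑ j ∈ A, X j ω * c j|, ∑ j ∈ A, X j ω * g j))
      (fun ω => ∑ j ∈ Aᶜ, X j ω * g j) μ := by
    have hblocks := (hX.indepFun_finset A Aᶜ disjoint_compl_right hm).comp
      (φ := fun w : A → ℝ => (ENNReal.ofReal |∑ j : A, w j * c j|, ∑ j : A, w j * g j))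
      (ψ := fun w : (Aᶜ : Finset ι) → ℝ => ∑ j : (Aᶜ : Finset ι), w j * g j)
      (by fun_prop) (by fun_prop)
    convert hblocks using 1 <;> ext ω <;> simp only [comp_apply]
    · rw [Finset.sum_coe_sort A fun j => X j ω * c j]
    · exact (Finset.sum_coe_sort A fun j => X j ω * g j).symm
    · exact (Finset.sum_coe_sort Aᶜ fun j => X j ω * g j).symm
  calc ∫⁻ ω, ENNReal.ofReal |∑ j ∈ A, X j ω * c j| * B.indicator 1 (∑ j, X j ω * g j) ∂μ
      = ∫⁻ ω, ENNReal.ofReal |∑ j ∈ A, X j ω * c j| *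
          B.indicator 1 (∑ j ∈ A, X j ω * g j + ∑ j ∈ Aᶜ, X j ω * g j) ∂μ := by
        simp only [Finset.sum_add_sum_compl]
    _ ≤ (∫⁻ ω, ENNReal.ofReal |∑ j ∈ A, X j ω * c j| ∂μ) *
          (ENNReal.ofReal (1 / (2 * √(b * ∑ j ∈ Aᶜ, g j ^ 2))) * volume B) :=
        lintegral_mul_indicator_add_le_of_indepFun (by fun_prop) (by fun_prop) (by fun_prop) hind
          (map_sum_mul_le_smul_volume hX hm hb h hg) hB
    _ ≤ ENNReal.ofReal √(∑ j ∈ A, c j ^ 2) *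
          (ENNReal.ofReal (1 / (2 * √(b * ∑ j ∈ Aᶜ, g j ^ 2))) * volume B) := by
        gcongr
        rw [← integral_sum_mul_sq hX hm hmem h0 h2]
        exact lintegral_ofReal_abs_le_sqrt_integral_sq
          (memLp_finsetSum _ fun j _ => (hmem j).mul_const (c j))
    _ = ENNReal.ofReal (√(∑ j ∈ A, c j ^ 2) * (1 / (2 * √(b * ∑ j ∈ Aᶜ, g j ^ 2)))) *
          volume B := by
        rw [ENNReal.ofReal_mul (Real.sqrt_nonneg _), mul_assoc]

end LinearForms

lemma exists_finset_sum_mem_Icc {ι : Type*} [Fintype ι] {x : ι → ℝ} (hpos : 0 < ∑ i, x i)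
    (hle : ∀ i, x i ≤ (∑ i, x i) / 3) :
    ∃ A : Finset ι, ∑ i ∈ A, x i ∈ Icc ((∑ i, x i) / 3) (2 * (∑ i, x i) / 3) := by
  classical
  by_contra! hno
  have hsmall : ∀ s : Finset ι, ∑ i ∈ s, x i < (∑ i, x i) / 3 := by
    intro s
    induction s using Finset.induction_on with
    | empty => simpa using hpos
    | insert k s hk ih =>
      by_contra! h
      have hlarge := not_and.1 (hno (insert k s)) h
      rw [Finset.sum_insert hk] at hlarge
      linarith [hle k]
  linarith [hsmall Finset.univ]

section GramDeterminant

variable {ι : Type*} [Fintype ι]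

/-- The Gram determinant of the vectors `g` and `g'`. -/
def gramDet (g g' : ι → ℝ) : ℝ :=
  (∑ j, g' j ^ 2) * (∑ j, g j ^ 2) - (∑ j, g j * g' j) ^ 2

lemma gramDet_nonneg (g g' : ι → ℝ) : 0 ≤ gramDet g g' := by
  rw [gramDet, sub_nonneg, mul_comm]
  exact Finset.sum_mul_sq_le_sq_mul_sq _ g g'

lemma gramDet_sub_mul (g g' : ι → ℝ) (τ : ℝ) :
    gramDet g (fun j => g' j - τ * g j) = gramDet g g' := by
  have hsq : ∑ j, (g' j - τ * g j) ^ 2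
      = ∑ j, g' j ^ 2 - 2 * τ * ∑ j, g j * g' j + τ ^ 2 * ∑ j, g j ^ 2 := by
    simp only [Finset.mul_sum, ← Finset.sum_sub_distrib, ← Finset.sum_add_distrib]
    exact Finset.sum_congr rfl fun j _ => by ring
  have hmul : ∑ j, g j * (g' j - τ * g j) = ∑ j, g j * g' j - τ * ∑ j, g j ^ 2 := by
    simp only [Finset.mul_sum, ← Finset.sum_sub_distrib]
    exact Finset.sum_congr rfl fun j _ => by ring
  rw [gramDet, gramDet, hsq, hmul]
  ring

lemma mul_sum_sq_le_gramDet {g c : ι → ℝ} {m : ι} (hm : c m = 0) :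
    g m ^ 2 * ∑ j, c j ^ 2 ≤ gramDet g c := by
  classical
  have hsplit : ∀ x : ι → ℝ, ∑ j, x j = x m + ∑ j ∈ {m}ᶜ, x j := Fintype.sum_eq_add_sum_compl m
  rw [gramDet, hsplit fun j => c j ^ 2, hsplit fun j => g j ^ 2, hsplit fun j => g j * c j, hm]
  linarith [Finset.sum_mul_sq_le_sq_mul_sq {m}ᶜ g c]

lemma sum_sq_sub_mul_mul_sum_sq {g : ι → ℝ} (hg : ∑ j, g j ^ 2 ≠ 0) (g' : ι → ℝ) :
    (∑ j, (g' j - (∑ i, g i * g' i) / (∑ i, g i ^ 2) * g j) ^ 2) * ∑ j, g j ^ 2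
      = gramDet g g' := by
  set τ := (∑ i, g i * g' i) / ∑ i, g i ^ 2 with hτ
  have horth : ∑ j, g j * (g' j - τ * g j) = 0 := by
    calc ∑ j, g j * (g' j - τ * g j) = ∑ j, g j * g' j - τ * ∑ j, g j ^ 2 := by
          rw [Finset.mul_sum, ← Finset.sum_sub_distrib]
          exact Finset.sum_congr rfl fun j _ => by ring
      _ = 0 := by rw [hτ, div_mul_cancel₀ _ hg, sub_self]
  rw [← gramDet_sub_mul g g' τ, gramDet, horth]
  ring

end GramDeterminant

section SliceBound

lemma sqrt_mul_one_div_le {b D G K Δ t : ℝ} (hb : 0 < b) (hG : 0 < G) (hK : 0 < K) (ht : 0 ≤ t)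
    (h : D * K ^ 2 ≤ 12 * t ^ 2 * Δ * G) :
    √D * (1 / (2 * √(b * G))) ≤ t * (√3 / √b * (√Δ / K)) := by
  have hroot : √D * K ≤ 2 * t * (√3 * √Δ * √G) := by
    calc √D * K = √(D * K ^ 2) := by rw [Real.sqrt_mul' _ (sq_nonneg K), Real.sqrt_sq hK.le]
      _ ≤ √((2 * t) ^ 2 * (3 * Δ * G)) := Real.sqrt_le_sqrt (by linarith)
      _ = 2 * t * (√3 * √Δ * √G) := by
        rw [Real.sqrt_mul (sq_nonneg _), Real.sqrt_sq (by positivity), Real.sqrt_mul' _ hG.le,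
          Real.sqrt_mul zero_le_three]
  calc √D * (1 / (2 * √(b * G))) = √D * K / (2 * √b * √G * K) := by
        rw [Real.sqrt_mul hb.le]
        field_simp
    _ ≤ 2 * t * (√3 * √Δ * √G) / (2 * √b * √G * K) := by gcongr
    _ = t * (√3 / √b * (√Δ / K)) := by field_simp

variable {ι : Type*} [Fintype ι] [DecidableEq ι] {ν : ι → Measure ℝ} {p : ℝ → ℝ}
  {g : ι → ℝ} {k : ι}

lemma sliceIntegral_abs_sub_mul (hk : g k ≠ 0) (g' : ι → ℝ) (τ : ℝ) :
    sliceIntegral ν p g k (fun v => ENNReal.ofReal |∑ j, v j * (g' j - τ * g j)|) 0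
      = sliceIntegral ν p g k (fun v => ENNReal.ofReal |∑ j, v j * g' j|) 0 := by
  have hlinear : ∀ u : ι → ℝ, ∑ j, u j * (g' j - τ * g j)
      = ∑ j, u j * g' j - τ * ∑ j, u j * g j := fun u => by
    rw [Finset.mul_sum, ← Finset.sum_sub_distrib]
    exact Finset.sum_congr rfl fun j _ => by ring
  simp only [sliceIntegral, hlinear, sum_update_slicePoint hk, mul_zero, sub_zero]

lemma sliceIntegral_mono {F G : (ι → ℝ) → ℝ≥0∞} (hFG : ∀ v, F v ≤ G v) (y : ℝ) :
    sliceIntegral ν p g k F y ≤ sliceIntegral ν p g k G y := by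
  unfold sliceIntegral
  gcongr
  exact hFG _

lemma sliceIntegral_add (hp : Measurable p) {F : (ι → ℝ) → ℝ≥0∞} (hF : Measurable F)
    (G : (ι → ℝ) → ℝ≥0∞) (y : ℝ) :
    sliceIntegral ν p g k (fun v => F v + G v) y
      = sliceIntegral ν p g k F y + sliceIntegral ν p g k G y := by
  simp only [sliceIntegral, add_mul]
  rw [lintegral_add_left (by fun_prop), mul_add]

variable [∀ i, IsProbabilityMeasure (ν i)] (hp : Continuous p)
  (hν : ν k = volume.withDensity fun x => ENNReal.ofReal (p x)) {b : ℝ} (hb : 0 < b)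
  (h : ∀ i s, ‖charFun (ν i) s‖ ≤ 1 / (1 + b * s ^ 2)) (hmem : ∀ i, MemLp id 2 (ν i))
  (h0 : ∀ i, ∫ x, x ∂ν i = 0) (h2 : ∀ i, ∫ x, x ^ 2 ∂ν i = 1) (hk : g k ≠ 0)

include hp hν hb h hmem h0 h2 hk

lemma sliceIntegral_abs_sum_le (c : ι → ℝ) {A : Finset ι} (hA : 0 < ∑ j ∈ Aᶜ, g j ^ 2) :
    sliceIntegral ν p g k (fun v => ENNReal.ofReal |∑ j ∈ A, v j * c j|) 0
      ≤ ENNReal.ofReal (√(∑ j ∈ A, c j ^ 2) * (1 / (2 * √(b * ∑ j ∈ Aᶜ, g j ^ 2)))) := by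
  have hcoord : ∀ i, (Measure.pi ν).map (fun v => v i) = ν i :=
    fun i => (measurePreserving_eval ν i).map_eq
  refine sliceIntegral_le_of_forall_lintegral_le hp hν hk
    (ENNReal.continuous_ofReal.comp (by fun_prop)) (fun _ => ENNReal.ofReal_ne_top)
    (fun B hB => ?_) 0
  refine lintegral_abs_sum_mul_indicator_le (X := fun i (v : ι → ℝ) => v i)
    (iIndepFun_pi fun i => aemeasurable_id)
    (by fun_prop) hb (fun i => by rw [hcoord]; exact h i) (fun i => ?_) (fun i => ?_) (fun i => ?_)
    c hA hB
  · exact (hmem i).comp_measurePreserving (measurePreserving_eval ν i)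
  · exact (integral_comp_eval (μ := ν) (f := fun x => x) aestronglyMeasurable_id).trans (h0 i)
  · exact (integral_comp_eval (by fun_prop)).trans (h2 i)

lemma sliceIntegral_abs_sum_le_of_le {c g' : ι → ℝ} {A : Finset ι} {t : ℝ} (ht : 0 ≤ t)
    (hA : 0 < ∑ j ∈ Aᶜ, g j ^ 2)
    (hle : (∑ j ∈ A, c j ^ 2) * (∑ j, g j ^ 2) ^ 2
      ≤ 12 * t ^ 2 * gramDet g g' * ∑ j ∈ Aᶜ, g j ^ 2) :
    sliceIntegral ν p g k (fun v => ENNReal.ofReal |∑ j ∈ A, v j * c j|) 0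
      ≤ ENNReal.ofReal (t * (√3 / √b * (√(gramDet g g') / ∑ j, g j ^ 2))) := by
  have hK : 0 < ∑ j, g j ^ 2 := hA.trans_le <|
    Finset.sum_le_univ_sum_of_nonneg fun j => sq_nonneg (g j)
  exact (sliceIntegral_abs_sum_le hp hν hb h hmem h0 h2 hk c hA).trans <|
    ENNReal.ofReal_le_ofReal (sqrt_mul_one_div_le hb hA hK ht hle)

lemma sliceIntegral_abs_le_of_dominant (g' : ι → ℝ) {m : ι} (hm0 : g m ≠ 0)
    (hm : (∑ j, g j ^ 2) / 3 ≤ g m ^ 2) :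
    sliceIntegral ν p g k (fun v => ENNReal.ofReal |∑ j, v j * g' j|) 0
      ≤ ENNReal.ofReal (√3 / √b * (√(gramDet g g') / ∑ j, g j ^ 2)) := by
  set c : ι → ℝ := fun j => g' j - g' m / g m * g j with hc
  have hcm : c m = 0 := by simp [hc, hm0]
  have hcompl : ∑ j ∈ ({m}ᶜ : Finset ι)ᶜ, g j ^ 2 = g m ^ 2 := by simp
  have hdrop : sliceIntegral ν p g k (fun v => ENNReal.ofReal |∑ j, v j * g' j|) 0
      = sliceIntegral ν p g k (fun v => ENNReal.ofReal |∑ j ∈ {m}ᶜ, v j * c j|) 0 := by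
    rw [← sliceIntegral_abs_sub_mul hk g' (g' m / g m)]
    congr with v
    change ENNReal.ofReal |∑ j, v j * c j| = _
    rw [Fintype.sum_eq_add_sum_compl m (fun j => v j * c j), hcm, mul_zero, zero_add]
  have hgram : g m ^ 2 * ∑ j ∈ {m}ᶜ, c j ^ 2 ≤ gramDet g g' := by
    rw [← gramDet_sub_mul g g' (g' m / g m)]
    refine le_trans ?_ (mul_sum_sq_le_gramDet hcm)
    gcongr
    exact Finset.subset_univ _
  have hgm : 0 < g m ^ 2 := by positivity
  have : 0 ≤ ∑ j, g j ^ 2 := by positivity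
  rw [hdrop, ← one_mul (√3 / √b * _)]
  refine sliceIntegral_abs_sum_le_of_le hp hν hb h hmem h0 h2 hk zero_le_one (by rwa [hcompl]) ?_
  rw [hcompl]
  calc (∑ j ∈ {m}ᶜ, c j ^ 2) * (∑ j, g j ^ 2) ^ 2
      ≤ (∑ j ∈ {m}ᶜ, c j ^ 2) * (3 * g m ^ 2) ^ 2 := by gcongr; linarith
    _ = 9 * (g m ^ 2 * ∑ j ∈ {m}ᶜ, c j ^ 2) * g m ^ 2 := by ring
    _ ≤ 12 * gramDet g g' * g m ^ 2 := by
        gcongr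
        · norm_num
    _ = 12 * 1 ^ 2 * gramDet g g' * g m ^ 2 := by ring

lemma sliceIntegral_abs_le_of_balanced (g' : ι → ℝ) {A : Finset ι} (hK : 0 < ∑ j, g j ^ 2)
    (hA : ∑ j ∈ A, g j ^ 2 ∈ Icc ((∑ j, g j ^ 2) / 3) (2 * (∑ j, g j ^ 2) / 3)) :
    sliceIntegral ν p g k (fun v => ENNReal.ofReal |∑ j, v j * g' j|) 0
      ≤ ENNReal.ofReal (√3 / √b * (√(gramDet g g') / ∑ j, g j ^ 2)) := by
  set K := ∑ j, g j ^ 2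
  set τ := (∑ j, g j * g' j) / K
  set c : ι → ℝ := fun j => g' j - τ * g j
  have hgram : (∑ j, c j ^ 2) * K = gramDet g g' := sum_sq_sub_mul_mul_sum_sq hK.ne' g'
  have hhalf : ∀ B : Finset ι, K / 3 ≤ ∑ j ∈ Bᶜ, g j ^ 2 →
      sliceIntegral ν p g k (fun v => ENNReal.ofReal |∑ j ∈ B, v j * c j|) 0
        ≤ ENNReal.ofReal (1 / 2 * (√3 / √b * (√(gramDet g g') / K))) := by
    intro B hB
    refine sliceIntegral_abs_sum_le_of_le hp hν hb h hmem h0 h2 hk (by norm_num)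
      (hB.trans_lt' (by positivity)) ?_
    calc (∑ j ∈ B, c j ^ 2) * K ^ 2
        ≤ (∑ j, c j ^ 2) * K ^ 2 := by
          gcongr
          exact Finset.subset_univ B
      _ = 12 * (1 / 2) ^ 2 * gramDet g g' * (K / 3) := by rw [← hgram]; ring
      _ ≤ 12 * (1 / 2) ^ 2 * gramDet g g' * ∑ j ∈ Bᶜ, g j ^ 2 := by
          have := gramDet_nonneg g g'
          gcongr
  have hcompl : ∑ j ∈ A, g j ^ 2 + ∑ j ∈ Aᶜ, g j ^ 2 = K := Finset.sum_add_sum_compl A _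
  calc sliceIntegral ν p g k (fun v => ENNReal.ofReal |∑ j, v j * g' j|) 0
      = sliceIntegral ν p g k (fun v => ENNReal.ofReal |∑ j, v j * c j|) 0 :=
        (sliceIntegral_abs_sub_mul hk g' τ).symm
    _ ≤ sliceIntegral ν p g k (fun v => ENNReal.ofReal |∑ j ∈ A, v j * c j| +
          ENNReal.ofReal |∑ j ∈ Aᶜ, v j * c j|) 0 := by
        refine sliceIntegral_mono (fun v => ?_) 0
        rw [← Finset.sum_add_sum_compl A, ← ENNReal.ofReal_add (abs_nonneg _) (abs_nonneg _)]
        exact ENNReal.ofReal_le_ofReal (abs_add_le _ _)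
    _ ≤ ENNReal.ofReal (1 / 2 * (√3 / √b * (√(gramDet g g') / K))) +
          ENNReal.ofReal (1 / 2 * (√3 / √b * (√(gramDet g g') / K))) := by
        rw [sliceIntegral_add (by fun_prop) (by fun_prop)]
        exact add_le_add (hhalf A (by linarith [hA.2]))
          (hhalf Aᶜ (by rw [compl_compl]; exact hA.1))
    _ = ENNReal.ofReal (√3 / √b * (√(gramDet g g') / K)) := by
        rw [← ENNReal.ofReal_add (by positivity) (by positivity), ← add_mul, add_halves, one_mul]

theorem sliceIntegral_abs_le (g' : ι → ℝ) :
    sliceIntegral ν p g k (fun v => ENNReal.ofReal |∑ j, v j * g' j|) 0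
      ≤ ENNReal.ofReal (√3 / √b * (√(gramDet g g') / ∑ j, g j ^ 2)) := by
  have hK : 0 < ∑ j, g j ^ 2 := (by positivity : 0 < g k ^ 2).trans_le <|
    Finset.single_le_sum (f := fun j => g j ^ 2) (fun j _ => sq_nonneg _) (Finset.mem_univ k)
  by_cases hdom : ∃ m, (∑ j, g j ^ 2) / 3 ≤ g m ^ 2
  · obtain ⟨m, hm⟩ := hdom
    have hm0 : g m ≠ 0 := sq_pos_iff.1 (hm.trans_lt' (by positivity))
    exact sliceIntegral_abs_le_of_dominant hp hν hb h hmem h0 h2 hk g' hm0 hm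
  · push Not at hdom
    obtain ⟨A, hA⟩ := exists_finset_sum_mem_Icc hK fun j => (hdom j).le
    exact sliceIntegral_abs_le_of_balanced hp hν hb h hmem h0 h2 hk g' hK hA

end SliceBound

lemma measurable_of_hasDerivAt {g g' : ℝ → ℝ} (hd : ∀ x, HasDerivAt g (g' x) x) : Measurable g :=
  (continuous_iff_continuousAt.2 fun x => (hd x).continuousAt).measurable

lemma measurable_deriv_of_hasDerivAt {g g' : ℝ → ℝ} (hd : ∀ x, HasDerivAt g (g' x) x) :
    Measurable g' := by
  rw [show g' = deriv g from funext fun x => (hd x).deriv.symm]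
  exact measurable_deriv g

section KacRice

variable {ι : Type*} [DecidableEq ι] {g g' : ι → ℝ → ℝ} {k : ι}

lemma hasFDerivAt_update_apply [Finite ι] {h : (ι → ℝ) → ℝ} {D : (ι → ℝ) →L[ℝ] ℝ} {w : ι → ℝ}
    (hh : HasFDerivAt h D w) (k : ι) :
    HasFDerivAt (fun w => update w k (h w)) (ContinuousLinearMap.id ℝ (ι → ℝ) +
      (D - ContinuousLinearMap.proj k).smulRight (Pi.single k 1)) w := by
  have := Fintype.ofFinite ι
  have hsum : (fun w => update w k (h w))
      = fun w => w + (h w - w k) • Pi.single (M := fun _ => ℝ) k 1 := by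
    ext w j
    rcases eq_or_ne j k with rfl | hj
    · simp
    · simp [hj]
  rw [hsum]
  exact (hasFDerivAt_id w).add ((hh.sub (hasFDerivAt_apply k w)).smul_const _)

lemma det_id_add_smulRight_single [Finite ι] (D : (ι → ℝ) →L[ℝ] ℝ) (k : ι) :
    (ContinuousLinearMap.id ℝ (ι → ℝ) +
      (D - ContinuousLinearMap.proj k).smulRight (Pi.single k 1)).det = D (Pi.single k 1) := by
  have htransvection : ((ContinuousLinearMap.id ℝ (ι → ℝ) +
      (D - ContinuousLinearMap.proj k).smulRight (Pi.single k 1) :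
        (ι → ℝ) →L[ℝ] (ι → ℝ)) : (ι → ℝ) →ₗ[ℝ] (ι → ℝ))
      = LinearMap.transvection ((D - ContinuousLinearMap.proj k : (ι → ℝ) →L[ℝ] ℝ) :
          (ι → ℝ) →ₗ[ℝ] ℝ) (Pi.single k 1) := rfl
  rw [ContinuousLinearMap.det, htransvection, LinearMap.transvection.det]
  simp

variable [Fintype ι]

/-- The map that reads the `k`-th coordinate `w k` as a point of the real line and replaces it by
the value for which `∑ j, w j * g j` vanishes at that point. -/
noncomputable def zeroMap (g : ι → ℝ → ℝ) (k : ι) (w : ι → ℝ) : ι → ℝ :=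
  update w k (slicePoint (fun j => g j (w k)) k 0 w)

/-- The Jacobian determinant of `zeroMap g k`, where `g'` is the derivative of `g`. -/
noncomputable def zeroMapJacobian (g g' : ι → ℝ → ℝ) (k : ι) (w : ι → ℝ) : ℝ :=
  -(∑ j, zeroMap g k w j * g' j (w k)) / g k (w k)

lemma zeroMap_update {x : ℝ} (hx : g k x ≠ 0) (v : ι → ℝ) :
    zeroMap g k (update v k x) = update v k (slicePoint (fun j => g j x) k 0 v) := by
  rw [zeroMap, update_self, update_idem, slicePoint_update (c := fun j => g j x) hx]

lemma encard_zeroMap_fibre {S : Set ℝ} (hS : ∀ x ∈ S, g k x ≠ 0) (y : ι → ℝ) :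
    ({w | w k ∈ S} ∩ zeroMap g k ⁻¹' {y}).encard
      = {x | x ∈ S ∧ ∑ j, y j * g j x = 0}.encard := by
  rw [← (update_injective y k).encard_image]
  congr 1
  ext w
  constructor
  · rintro ⟨hw, rfl⟩
    refine ⟨w k, ⟨hw, ?_⟩, ?_⟩
    · exact sum_update_slicePoint (c := fun j => g j (w k)) (hS _ hw) 0 w
    · rw [zeroMap, update_idem, update_eq_self]
  · rintro ⟨x, ⟨hx, hzero⟩, rfl⟩
    refine ⟨by simpa using hx, ?_⟩
    rw [mem_preimage, zeroMap_update (hS x hx), slicePoint, hzero, sub_zero, zero_div, add_zero,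
      update_eq_self, mem_singleton_iff]

lemma abs_zeroMapJacobian_update_mul {x : ℝ} (hx : g k x ≠ 0) (p : ℝ → ℝ) (v : ι → ℝ) :
    ENNReal.ofReal |zeroMapJacobian g g' k (update v k x)| *
        ENNReal.ofReal (p (zeroMap g k (update v k x) k))
      = ENNReal.ofReal |g k x|⁻¹ *
        (ENNReal.ofReal |∑ j, update v k (slicePoint (fun j => g j x) k 0 v) j * g' j x| *
          ENNReal.ofReal (p (slicePoint (fun j => g j x) k 0 v))) := by
  rw [zeroMapJacobian, zeroMap_update hx, update_self, update_self, abs_div, abs_neg,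
    div_eq_inv_mul, ENNReal.ofReal_mul (inv_nonneg.2 (abs_nonneg _)), mul_assoc]

variable (hd : ∀ j x, HasDerivAt (g j) (g' j x) x)

include hd

lemma hasDerivAt_slicePoint {x : ℝ} (hx : g k x ≠ 0) (v : ι → ℝ) :
    HasDerivAt (fun t => slicePoint (fun j => g j t) k 0 v)
      (-(∑ j, update v k (slicePoint (fun j => g j x) k 0 v) j * g' j x) / g k x) x := by
  have hsum : HasDerivAt (fun t => ∑ j, v j * g j t) (∑ j, v j * g' j x) x :=
    HasDerivAt.fun_sum fun j _ => (hd j x).const_mul (v j)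
  refine (((hsum.const_sub 0).div (hd k x) hx).const_add (v k)).congr_deriv ?_
  rw [sum_update_mul (fun j => g' j x), slicePoint]
  field_simp
  ring

lemma exists_hasFDerivAt_slicePoint {w : ι → ℝ} (hw : g k (w k) ≠ 0) :
    ∃ D : (ι → ℝ) →L[ℝ] ℝ, HasFDerivAt (fun w => slicePoint (fun j => g j (w k)) k 0 w) D w ∧
      D (Pi.single k 1) = zeroMapJacobian g g' k w := by
  set h : (ι → ℝ) → ℝ := fun w => slicePoint (fun j => g j (w k)) k 0 w
  have hg : ∀ j, DifferentiableAt ℝ (g j) (w k) := fun j => (hd j (w k)).differentiableAt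
  have hdiff : HasFDerivAt h (fderiv ℝ h w) w :=
    DifferentiableAt.hasFDerivAt (by simp only [h, slicePoint]; fun_prop (disch := exact hw))
  refine ⟨_, hdiff, ?_⟩
  have hline : HasDerivAt (fun t => h (update w k t)) (fderiv ℝ h w (Pi.single k 1)) (w k) := by
    exact hdiff.comp_hasDerivAt_of_eq (w k) (hasDerivAt_update w k (w k)) (update_eq_self k w).symm
  refine hline.unique ((hasDerivAt_slicePoint hd hw w).congr_of_eventuallyEq ?_)
  filter_upwards [(hd k (w k)).continuousAt.eventually_ne hw] with t ht
  simp only [h, update_self]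
  exact slicePoint_update (c := fun j => g j t) ht t 0 w

lemma exists_hasFDerivAt_zeroMap {w : ι → ℝ} (hw : g k (w k) ≠ 0) :
    ∃ T' : (ι → ℝ) →L[ℝ] (ι → ℝ),
      HasFDerivAt (zeroMap g k) T' w ∧ T'.det = zeroMapJacobian g g' k w := by
  obtain ⟨D, hD, hDk⟩ := exists_hasFDerivAt_slicePoint hd hw
  exact ⟨_, hasFDerivAt_update_apply hD k, (det_id_add_smulRight_single D k).trans hDk⟩

lemma measurable_zeroMap (k : ι) : Measurable (zeroMap g k) := by
  have hg : ∀ j, Measurable (g j) := fun j => measurable_of_hasDerivAt (hd j)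
  unfold zeroMap slicePoint
  fun_prop

lemma measurable_zeroMapJacobian (k : ι) : Measurable (zeroMapJacobian g g' k) := by
  have hg : ∀ j, Measurable (g j) := fun j => measurable_of_hasDerivAt (hd j)
  have hg' : ∀ j, Measurable (g' j) := fun j => measurable_deriv_of_hasDerivAt (hd j)
  have hzero := measurable_zeroMap hd k
  unfold zeroMapJacobian
  fun_prop

lemma area_formula_zeroMap {S : Set ℝ} (hSm : MeasurableSet S) (hS : ∀ x ∈ S, g k x ≠ 0) :
    AEMeasurable (fun v : ι → ℝ => ({x | x ∈ S ∧ ∑ j, v j * g j x = 0}.encard : ℝ≥0∞)) ∧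
      ∀ W : (ι → ℝ) → ℝ≥0∞, Measurable W →
        ∫⁻ v, ({x | x ∈ S ∧ ∑ j, v j * g j x = 0}.encard : ℝ≥0∞) * W v
          = ∫⁻ w in {w | w k ∈ S},
              ENNReal.ofReal |zeroMapJacobian g g' k w| * W (zeroMap g k w) := by
  have hsm : MeasurableSet {w : ι → ℝ | w k ∈ S} := hSm.preimage (measurable_pi_apply k)
  choose! T' hT' hdet using fun w (hw : w ∈ {w : ι → ℝ | w k ∈ S}) =>
    exists_hasFDerivAt_zeroMap hd (hS (w k) hw)
  obtain ⟨hmeas, harea⟩ := area_formula volume hsm fun w hw => (hT' w hw).hasFDerivWithinAt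
  simp_rw [encard_zeroMap_fibre hS] at hmeas harea
  refine ⟨hmeas, fun W hW => (harea W hW).trans ?_⟩
  exact setLIntegral_congr_fun hsm fun w hw => by rw [hdet w hw]

variable {ν : ι → Measure ℝ} [∀ i, IsProbabilityMeasure (ν i)] {p : ι → ℝ → ℝ}
  (hp : ∀ i, Measurable (p i)) (hν : ∀ i, ν i = volume.withDensity fun x => ENNReal.ofReal (p i x))

include hp hν

lemma setLIntegral_zeroMapJacobian_mul {S : Set ℝ} (hSm : MeasurableSet S)
    (hS : ∀ x ∈ S, g k x ≠ 0) :
    ∫⁻ w in {w | w k ∈ S}, ENNReal.ofReal |zeroMapJacobian g g' k w| *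
        ∏ j, ENNReal.ofReal (p j (zeroMap g k w j))
      = ∫⁻ x in S, sliceIntegral ν (p k) (fun j => g j x) k
          (fun v => ENNReal.ofReal |∑ j, v j * g' j x|) 0 := by
  have hJ := measurable_zeroMapJacobian hd k
  have hT := measurable_zeroMap hd k
  have hsm : MeasurableSet {w : ι → ℝ | w k ∈ S} := hSm.preimage (measurable_pi_apply k)
  set Ψ : (ι → ℝ) → ℝ≥0∞ := fun w =>
    ENNReal.ofReal |zeroMapJacobian g g' k w| * ENNReal.ofReal (p k (zeroMap g k w k)) with hΨ
  have hΨm : Measurable Ψ := by fun_prop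
  have hprod : ∀ w, ENNReal.ofReal |zeroMapJacobian g g' k w| *
      ∏ j, ENNReal.ofReal (p j (zeroMap g k w j))
        = (∏ j ∈ Finset.univ.erase k, ENNReal.ofReal (p j (w j))) * Ψ w := fun w => by
    rw [← Finset.mul_prod_erase _ _ (Finset.mem_univ k), ← mul_assoc, mul_comm, zeroMap,
      prod_update_apply (fun j x => ENNReal.ofReal (p j x)) (Finset.notMem_erase k _)]
    simp only [hΨ, zeroMap]
  obtain rfl : ν = fun i => volume.withDensity fun x => ENNReal.ofReal (p i x) := funext hν
  have hpk : ∫⁻ x, ENNReal.ofReal (p k x) = 1 := by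
    rw [← setLIntegral_univ, ← withDensity_apply _ MeasurableSet.univ]
    exact measure_univ
  calc ∫⁻ w in {w | w k ∈ S}, ENNReal.ofReal |zeroMapJacobian g g' k w| *
        ∏ j, ENNReal.ofReal (p j (zeroMap g k w j))
      = ∫⁻ w, (∏ j ∈ Finset.univ.erase k, ENNReal.ofReal (p j (w j))) *
          {w | w k ∈ S}.indicator Ψ w := by
        rw [← lintegral_indicator hsm]
        simp only [hprod, indicator_mul_right]
    _ = ∫⁻ x, ∫⁻ v, {w | w k ∈ S}.indicator Ψ (update v k x)
          ∂Measure.pi fun i => volume.withDensity fun x => ENNReal.ofReal (p i x) :=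
        lintegral_prod_erase_mul (μ := fun _ : ι => volume)
          (p := fun i x => ENNReal.ofReal (p i x)) k (by fun_prop) hpk (hΨm.indicator hsm)
    _ = ∫⁻ x in S, sliceIntegral _ (p k) (fun j => g j x) k
          (fun v => ENNReal.ofReal |∑ j, v j * g' j x|) 0 := by
        rw [← lintegral_indicator hSm]
        refine lintegral_congr fun x => ?_
        by_cases hx : x ∈ S
        · simp only [indicator, mem_ofPred_eq, update_self, hx, if_true, hΨ, sliceIntegral,
            abs_zeroMapJacobian_update_mul (hS x hx)]
          exact lintegral_const_mul' _ _ ENNReal.ofReal_ne_top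
        · simp only [indicator, mem_ofPred_eq, update_self, hx, if_false, lintegral_zero]

theorem kacRice_of_ne_zero {S : Set ℝ} (hSm : MeasurableSet S) (hS : ∀ x ∈ S, g k x ≠ 0) :
    AEMeasurable (fun v : ι → ℝ => ({x | x ∈ S ∧ ∑ j, v j * g j x = 0}.encard : ℝ≥0∞))
        (Measure.pi ν) ∧
      ∫⁻ v, ({x | x ∈ S ∧ ∑ j, v j * g j x = 0}.encard : ℝ≥0∞) ∂Measure.pi ν
        = ∫⁻ x in S, sliceIntegral ν (p k) (fun j => g j x) k
            (fun v => ENNReal.ofReal |∑ j, v j * g' j x|) 0 := by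
  obtain rfl : ν = fun i => volume.withDensity fun x => ENNReal.ofReal (p i x) := funext hν
  obtain ⟨hmeas, harea⟩ := area_formula_zeroMap hd hSm hS
  have hpi := pi_withDensity_eq (μ := fun _ : ι => volume) (p := fun i x => ENNReal.ofReal (p i x))
    (by fun_prop)
  rw [← volume_pi] at hpi
  have hW : Measurable fun v : ι → ℝ => ∏ j, ENNReal.ofReal (p j (v j)) := by fun_prop
  refine ⟨hmeas.mono_ac (hpi ▸ withDensity_absolutelyContinuous _ _), ?_⟩
  rw [← setLIntegral_zeroMapJacobian_mul hd hp hν hSm hS, ← harea _ hW, hpi,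
    lintegral_withDensity_eq_lintegral_mul₀ hW.aemeasurable hmeas]
  exact lintegral_congr fun v => mul_comm _ _

end KacRice

section JointDensity

variable {ι : Type*} [Fintype ι] {g g' e : ι → ℝ} {k l : ι}

lemma exists_sub_mul_ne_zero_of_gramDet_ne_zero (h : gramDet g g' ≠ 0) (τ : ℝ) :
    ∃ l, g' l - τ * g l ≠ 0 := by
  by_contra! hzero
  rw [← gramDet_sub_mul g g' τ, gramDet] at h
  simp [hzero] at h

variable [DecidableEq ι]

/-- The joint density of the linear forms `∑ j, v j * g j` and `∑ j, v j * e j` in the case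
`e k = 0`, computed by solving for the coordinates `k` and `l`; `p` and `q` are the densities of
`ν k` and `ν l`. -/
noncomputable def jointDensity (ν : ι → Measure ℝ) (p q : ℝ → ℝ) (g e : ι → ℝ) (k l : ι)
    (z : ℝ × ℝ) : ℝ :=
  |g k|⁻¹ * (|e l|⁻¹ * ∫ v, p (slicePoint g k z.1 (update v l (slicePoint e l z.2 v))) *
    q (slicePoint e l z.2 v) ∂Measure.pi ν)

variable {ν : ι → Measure ℝ} {p q : ℝ → ℝ}

lemma jointDensity_nonneg (hp0 : ∀ x, 0 ≤ p x) (hq0 : ∀ x, 0 ≤ q x) (z : ℝ × ℝ) :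
    0 ≤ jointDensity ν p q g e k l z := by
  have := integral_nonneg (μ := Measure.pi ν) (f := fun v =>
    p (slicePoint g k z.1 (update v l (slicePoint e l z.2 v))) * q (slicePoint e l z.2 v))
    fun v => mul_nonneg (hp0 _) (hq0 _)
  unfold jointDensity
  positivity

variable [∀ i, IsProbabilityMeasure (ν i)] (hp : Continuous p) (hp0 : ∀ x, 0 ≤ p x)
  {M : ℝ} (hpM : ∀ x, p x ≤ M) (hq : Continuous q) (hq0 : ∀ x, 0 ≤ q x) (hqM : ∀ x, q x ≤ M)

include hp hp0 hpM hq hq0 hqM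

lemma continuous_jointDensity : Continuous (jointDensity ν p q g e k l) := by
  refine continuous_const.mul (continuous_const.mul ?_)
  refine continuous_of_dominated (bound := fun _ => M * M) (fun z => ?_)
    (fun z => Eventually.of_forall fun v => ?_) (integrable_const _)
    (Eventually.of_forall fun v => by fun_prop)
  · exact (by fun_prop : Continuous _).aestronglyMeasurable
  · rw [Real.norm_of_nonneg (mul_nonneg (hp0 _) (hq0 _))]
    exact mul_le_mul (hpM _) (hqM _) (hq0 _) ((hp0 0).trans (hpM 0))

lemma ofReal_jointDensity (z : ℝ × ℝ) :
    ENNReal.ofReal (jointDensity ν p q g e k l z) = ENNReal.ofReal |g k|⁻¹ *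
      sliceIntegral ν q e l (fun v => ENNReal.ofReal (p (slicePoint g k z.1 v))) z.2 := by
  set F : (ι → ℝ) → ℝ := fun v =>
    p (slicePoint g k z.1 (update v l (slicePoint e l z.2 v))) * q (slicePoint e l z.2 v)
  have hF0 : ∀ v, 0 ≤ F v := fun v => mul_nonneg (hp0 _) (hq0 _)
  have hF : Integrable F (Measure.pi ν) := by
    refine Integrable.of_bound (C := M * M) (by fun_prop : Continuous F).aestronglyMeasurable
      (Eventually.of_forall fun v => ?_)
    rw [Real.norm_of_nonneg (hF0 v)]
    exact mul_le_mul (hpM _) (hqM _) (hq0 _) ((hp0 0).trans (hpM 0))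
  rw [jointDensity, ENNReal.ofReal_mul (by positivity), ENNReal.ofReal_mul (by positivity),
    ofReal_integral_eq_lintegral_ofReal hF (Eventually.of_forall hF0), sliceIntegral]
  simp only [F, ENNReal.ofReal_mul (hp0 _)]

lemma sliceIntegral_eq_lintegral_jointDensity
    (hνl : ν l = volume.withDensity fun x => ENNReal.ofReal (q x)) (he : e k = 0) (hl : e l ≠ 0)
    (x : ℝ) {Φ : ℝ → ℝ≥0∞} (hΦ : Measurable Φ) :
    sliceIntegral ν p g k (fun v => Φ (∑ j, v j * e j)) x
      = ∫⁻ y, Φ y * ENNReal.ofReal (jointDensity ν p q g e k l (x, y)) := by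
  have hpull : ∀ y, sliceIntegral ν q e l
      (fun v => Φ y * ENNReal.ofReal (p (slicePoint g k x v))) y
        = Φ y * sliceIntegral ν q e l (fun v => ENNReal.ofReal (p (slicePoint g k x v))) y := by
    intro y
    simp only [sliceIntegral, mul_assoc (Φ y)]
    rw [lintegral_const_mul _ (by fun_prop), mul_left_comm]
  simp only [ofReal_jointDensity hp hp0 hpM hq hq0 hqM, mul_left_comm (Φ _), ← hpull]
  rw [lintegral_const_mul' _ _ ENNReal.ofReal_ne_top, ← lintegral_pi_eq_lintegral_sliceIntegral
    (H := fun y v => Φ y * ENNReal.ofReal (p (slicePoint g k x v))) hq.measurable hνl hl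
    (by fun_prop), sliceIntegral]
  simp only [sum_update_mul, he, zero_mul, mul_zero, sub_zero, zero_add]

lemma exists_continuous_density_sliceIntegral
    (hνl : ν l = volume.withDensity fun x => ENNReal.ofReal (q x)) (hk : g k ≠ 0)
    (hl : g' l - g' k / g k * g l ≠ 0) :
    ∃ D : ℝ × ℝ → ℝ, Continuous D ∧ (∀ z, 0 ≤ D z) ∧
      ∀ (x : ℝ) (Φ : ℝ → ℝ≥0∞), Measurable Φ →
        sliceIntegral ν p g k (fun v => Φ (∑ j, v j * g' j)) x
          = ∫⁻ y, Φ y * ENNReal.ofReal (D (x, y)) := by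
  set τ := g' k / g k
  have hek : g' k - τ * g k = 0 := by rw [div_mul_cancel₀ _ hk, sub_self]
  refine ⟨fun z => jointDensity ν p q g (fun j => g' j - τ * g j) k l (z.1, z.2 - τ * z.1),
    (continuous_jointDensity hp hp0 hpM hq hq0 hqM).comp (by fun_prop),
    fun z => jointDensity_nonneg hp0 hq0 _, fun x Φ hΦ => ?_⟩
  have hsum : ∀ v : ι → ℝ, ∑ j, update v k (slicePoint g k x v) j * g' j
      = ∑ j, update v k (slicePoint g k x v) j * (g' j - τ * g j) + τ * x := by
    intro v
    nth_rewrite 3 [← sum_update_slicePoint hk x v]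
    rw [Finset.mul_sum, ← Finset.sum_add_distrib]
    exact Finset.sum_congr rfl fun j _ => by ring
  calc sliceIntegral ν p g k (fun v => Φ (∑ j, v j * g' j)) x
      = sliceIntegral ν p g k (fun v => Φ (∑ j, v j * (g' j - τ * g j) + τ * x)) x := by
        simp only [sliceIntegral, hsum]
    _ = ∫⁻ y, Φ (y + τ * x) * ENNReal.ofReal (jointDensity ν p q g _ k l (x, y)) :=
        sliceIntegral_eq_lintegral_jointDensity hp hp0 hpM hq hq0 hqM hνl hek hl x
          (Φ := fun y => Φ (y + τ * x)) (by fun_prop)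
    _ = _ := by
        rw [← lintegral_sub_right_eq_self _ (τ * x)]
        simp only [sub_add_cancel]

omit hp hp0 hpM hq hq0 hqM

theorem exists_continuous_joint_density {p : ι → ℝ → ℝ} (hp : ∀ i, Continuous (p i))
    (hp0 : ∀ i x, 0 ≤ p i x) (hpM : ∀ i x, p i x ≤ M)
    (hν : ∀ i, ν i = volume.withDensity fun x => ENNReal.ofReal (p i x)) (hk : g k ≠ 0)
    (h : gramDet g g' ≠ 0) :
    ∃ D : ℝ × ℝ → ℝ, Continuous D ∧ (∀ z, 0 ≤ D z) ∧
      (Measure.pi ν).map (fun v => (∑ j, v j * g j, ∑ j, v j * g' j))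
        = volume.withDensity (fun z => ENNReal.ofReal (D z)) ∧
      sliceIntegral ν (p k) g k (fun v => ENNReal.ofReal |∑ j, v j * g' j|) 0
        = ∫⁻ y, ENNReal.ofReal (|y| * D (0, y)) := by
  obtain ⟨l, hl⟩ := exists_sub_mul_ne_zero_of_gramDet_ne_zero h (g' k / g k)
  obtain ⟨D, hD, hD0, hslice⟩ := exists_continuous_density_sliceIntegral (hp k) (hp0 k) (hpM k)
    (hp l) (hp0 l) (hpM l) (hν l) hk hl
  refine ⟨D, hD, hD0, Measure.ext_of_lintegral _ fun F hF => ?_, ?_⟩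
  · calc ∫⁻ z, F z ∂(Measure.pi ν).map (fun v => (∑ j, v j * g j, ∑ j, v j * g' j))
        = ∫⁻ v, F (∑ j, v j * g j, ∑ j, v j * g' j) ∂Measure.pi ν :=
          lintegral_map hF (by fun_prop)
      _ = ∫⁻ x, sliceIntegral ν (p k) g k (fun v => F (x, ∑ j, v j * g' j)) x :=
          lintegral_pi_eq_lintegral_sliceIntegral (H := fun x v => F (x, ∑ j, v j * g' j))
            (hp k).measurable (hν k) hk (by fun_prop)
      _ = ∫⁻ x, ∫⁻ y, F (x, y) * ENNReal.ofReal (D (x, y)) :=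
          lintegral_congr fun x => hslice x (fun y => F (x, y)) (by fun_prop)
      _ = ∫⁻ z, F z * ENNReal.ofReal (D z) :=
          (lintegral_prod (fun z => F z * ENNReal.ofReal (D z)) (by fun_prop)).symm
      _ = ∫⁻ z, F z ∂volume.withDensity (fun z => ENNReal.ofReal (D z)) := by
          rw [lintegral_withDensity_eq_lintegral_mul _ (by fun_prop) hF]
          exact lintegral_congr fun z => mul_comm _ _
  · rw [hslice 0 (fun y => ENNReal.ofReal |y|) (by fun_prop)]
    exact lintegral_congr fun y => (ENNReal.ofReal_mul (abs_nonneg _)).symm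

end JointDensity

section ZeroIntensity

variable {ι : Type*} [LinearOrder ι]

/-- The set of points at which `g k` is the first of the functions `g j` that does not vanish.
These sets are a measurable partition of the complement of the common zeros. -/
def firstNonzero (g : ι → ℝ → ℝ) (k : ι) : Set ℝ :=
  {x | g k x ≠ 0 ∧ ∀ j < k, g j x = 0}

lemma pairwise_disjoint_firstNonzero (g : ι → ℝ → ℝ) :
    Pairwise (Function.onFun Disjoint (firstNonzero g)) := by
  intro i j hij
  refine Set.disjoint_left.2 fun x hi hj => ?_
  rcases lt_or_gt_of_ne hij with h | h
  · exact hi.1 (hj.2 i h)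
  · exact hj.1 (hi.2 j h)

lemma measurableSet_firstNonzero [Countable ι] {g : ι → ℝ → ℝ} (hg : ∀ j, Measurable (g j))
    (k : ι) : MeasurableSet (firstNonzero g k) := by
  have hinter : firstNonzero g k = (g k ⁻¹' {0}ᶜ) ∩ ⋂ j, ⋂ (_ : j < k), g j ⁻¹' {0} := by
    ext x
    simp [firstNonzero]
  rw [hinter]
  exact (hg k (measurableSet_singleton 0).compl).inter
    (MeasurableSet.iInter fun j => MeasurableSet.iInter fun _ => hg j (measurableSet_singleton 0))

variable [Fintype ι]

lemma exists_mem_firstNonzero {g : ι → ℝ → ℝ} {x : ℝ} (h : ∑ j, g j x ^ 2 ≠ 0) :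
    ∃ k, x ∈ firstNonzero g k := by
  have hnonempty : {k | g k x ≠ 0}.Nonempty := by
    by_contra! hempty
    refine h (Finset.sum_eq_zero fun j _ => ?_)
    simpa using (hempty ▸ notMem_empty j : j ∉ {k | g k x ≠ 0})
  obtain ⟨k, hk, hmin⟩ := wellFounded_lt.has_min {k | g k x ≠ 0} hnonempty
  exact ⟨k, hk, fun j hj => by_contra fun h0 => hmin j h0 hj⟩

lemma iUnion_inter_firstNonzero {g : ι → ℝ → ℝ} {S : Set ℝ} (hS : ∀ x ∈ S, ∑ j, g j x ^ 2 ≠ 0) :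
    ⋃ k, S ∩ firstNonzero g k = S := by
  rw [← inter_iUnion, inter_eq_left]
  exact fun x hx => mem_iUnion.2 (exists_mem_firstNonzero (hS x hx))

lemma encard_eq_sum_encard_inter_firstNonzero {g : ι → ℝ → ℝ} {S : Set ℝ}
    (hS : ∀ x ∈ S, ∑ j, g j x ^ 2 ≠ 0) (Q : ℝ → Prop) :
    ({x | x ∈ S ∧ Q x}.encard : ℝ≥0∞)
      = ∑ k, ({x | x ∈ S ∩ firstNonzero g k ∧ Q x}.encard : ℝ≥0∞) := by
  have hunion : {x | x ∈ S ∧ Q x} = ⋃ k, {x | x ∈ S ∩ firstNonzero g k ∧ Q x} := by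
    ext x
    nth_rewrite 1 [← iUnion_inter_firstNonzero hS]
    simp only [mem_iUnion, mem_ofPred_eq, exists_and_right]
  rw [hunion, encard_iUnion_eq_tsum, tsum_fintype]
  exact fun i j hij => (pairwise_disjoint_firstNonzero g hij).mono
    (fun x hx => hx.1.2) fun x hx => hx.1.2

/-- The Kac–Rice intensity of the zeros of `∑ j, v j * g j`, where `g'` is the derivative of `g`
and the `v j` are independent with laws `ν j` and densities `p j`. -/
noncomputable def zeroIntensity (ν : ι → Measure ℝ) (p : ι → ℝ → ℝ) (g g' : ι → ℝ → ℝ) (x : ℝ) :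
    ℝ≥0∞ :=
  ∑ k, (firstNonzero g k).indicator (fun x => sliceIntegral ν (p k) (fun j => g j x) k
    (fun v => ENNReal.ofReal |∑ j, v j * g' j x|) 0) x

variable {ν : ι → Measure ℝ} {p : ι → ℝ → ℝ} {g g' : ι → ℝ → ℝ}

lemma zeroIntensity_eq_of_mem {k : ι} {x : ℝ} (hx : x ∈ firstNonzero g k) :
    zeroIntensity ν p g g' x = sliceIntegral ν (p k) (fun j => g j x) k
      (fun v => ENNReal.ofReal |∑ j, v j * g' j x|) 0 := by
  rw [zeroIntensity, Finset.sum_eq_single k, indicator_of_mem hx]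
  · intro j _ hj
    exact indicator_of_notMem
      (fun h => (pairwise_disjoint_firstNonzero g hj).notMem_of_mem_left h hx) _
  · simp

variable [∀ i, IsProbabilityMeasure (ν i)] (hp : ∀ i, Measurable (p i))
  (hd : ∀ j x, HasDerivAt (g j) (g' j x) x)

include hp hd

lemma measurable_zeroIntensity : Measurable (zeroIntensity ν p g g') := by
  have hg : ∀ j, Measurable (g j) := fun j => measurable_of_hasDerivAt (hd j)
  have hg' : ∀ j, Measurable (g' j) := fun j => measurable_deriv_of_hasDerivAt (hd j)
  unfold zeroIntensity sliceIntegral slicePoint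
  exact Finset.measurable_fun_sum _ fun k _ =>
    Measurable.indicator (by fun_prop) (measurableSet_firstNonzero hg k)

theorem kacRice (hν : ∀ i, ν i = volume.withDensity fun x => ENNReal.ofReal (p i x))
    {S : Set ℝ} (hSm : MeasurableSet S) (hS : ∀ x ∈ S, ∑ j, g j x ^ 2 ≠ 0) :
    AEMeasurable (fun v : ι → ℝ => ({x | x ∈ S ∧ ∑ j, v j * g j x = 0}.encard : ℝ≥0∞))
        (Measure.pi ν) ∧
      ∫⁻ v, ({x | x ∈ S ∧ ∑ j, v j * g j x = 0}.encard : ℝ≥0∞) ∂Measure.pi ν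
        = ∫⁻ x in S, zeroIntensity ν p g g' x := by
  have hpiece : ∀ k, MeasurableSet (S ∩ firstNonzero g k) := fun k =>
    hSm.inter (measurableSet_firstNonzero (fun j => measurable_of_hasDerivAt (hd j)) k)
  have hdisj : Pairwise (Function.onFun Disjoint fun k => S ∩ firstNonzero g k) := fun i j hij =>
    (pairwise_disjoint_firstNonzero g hij).mono inter_subset_right inter_subset_right
  have hk := fun k => kacRice_of_ne_zero hd hp hν (hpiece k) fun x hx => hx.2.1
  simp_rw [encard_eq_sum_encard_inter_firstNonzero hS]
  refine ⟨Finset.aemeasurable_fun_sum _ fun k _ => (hk k).1, ?_⟩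
  rw [lintegral_finsetSum' _ fun k _ => (hk k).1]
  nth_rewrite 2 [← iUnion_inter_firstNonzero hS]
  rw [lintegral_iUnion hpiece hdisj, tsum_fintype]
  refine Finset.sum_congr rfl fun k _ => (hk k).2.trans ?_
  exact setLIntegral_congr_fun (hpiece k) fun x hx => (zeroIntensity_eq_of_mem hx.2).symm

end ZeroIntensity

section CharFun

variable {ν : Measure ℝ}

lemma memLp_two_of_integral_sq_ne_zero (h : ∫ x, x ^ 2 ∂ν ≠ 0) : MemLp id 2 ν :=
  (memLp_two_iff_integrable_sq aestronglyMeasurable_id).2 (Integrable.of_integral_ne_zero h)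

variable [IsProbabilityMeasure ν]

lemma re_charFun_eq_integral_cos (s : ℝ) : (charFun ν s).re = ∫ x, Real.cos (s * x) ∂ν := by
  have hint : Integrable (fun x : ℝ => Complex.exp (s * x * Complex.I)) ν :=
    (integrable_const (1 : ℝ)).mono' (by fun_prop) <| Eventually.of_forall fun x => by
      rw [← Complex.ofReal_mul, Complex.norm_exp_ofReal_mul_I]
  rw [charFun_apply_real, ← RCLike.re_eq_complex_re, ← integral_re hint]
  refine integral_congr_ae (Eventually.of_forall fun x => ?_)
  simp only [RCLike.re_eq_complex_re]
  rw [← Complex.ofReal_mul, Complex.exp_ofReal_mul_I_re]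

lemma one_sub_le_norm_charFun (hmem : MemLp id 2 ν) (s : ℝ) :
    1 - s ^ 2 / 2 * ∫ x, x ^ 2 ∂ν ≤ ‖charFun ν s‖ := by
  have hsq : Integrable (fun x : ℝ => s ^ 2 / 2 * x ^ 2) ν := hmem.integrable_sq.const_mul _
  have hcos : Integrable (fun x => Real.cos (s * x)) ν :=
    (integrable_const (1 : ℝ)).mono' (by fun_prop)
      (Eventually.of_forall fun x => Real.abs_cos_le_one _)
  calc 1 - s ^ 2 / 2 * ∫ x, x ^ 2 ∂ν = ∫ x, (1 - s ^ 2 / 2 * x ^ 2) ∂ν := by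
        rw [integral_sub (integrable_const _) hsq, integral_const_mul, integral_const,
          probReal_univ, one_smul]
    _ ≤ ∫ x, Real.cos (s * x) ∂ν := by
        refine integral_mono ((integrable_const _).sub hsq) hcos fun x => ?_
        calc 1 - s ^ 2 / 2 * x ^ 2 = 1 - (s * x) ^ 2 / 2 := by ring
          _ ≤ Real.cos (s * x) := Real.one_sub_sq_div_two_le_cos
    _ ≤ ‖charFun ν s‖ := by
        rw [← re_charFun_eq_integral_cos]
        exact Complex.re_le_norm _

-- `9 / 17` comes from comparing the two bounds at `s = 1 / 3`.
lemma le_of_norm_charFun_le {b : ℝ} (hb : 0 < b) (h2 : ∫ x, x ^ 2 ∂ν = 1)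
    (h : ∀ s, ‖charFun ν s‖ ≤ 1 / (1 + b * s ^ 2)) : b ≤ 9 / 17 := by
  have hmem := memLp_two_of_integral_sq_ne_zero (h2.trans_ne one_ne_zero)
  have hthird := (one_sub_le_norm_charFun hmem (1 / 3)).trans (h (1 / 3))
  rw [h2, le_div_iff₀ (by positivity)] at hthird
  linarith

lemma norm_iteratedDeriv_two_charFun_zero (hmem : MemLp id 2 ν) :
    ‖iteratedDeriv 2 (charFun ν) 0‖ = ∫ x, x ^ 2 ∂ν := by
  rw [iteratedDeriv_charFun_zero (by exact_mod_cast hmem)]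
  have h0 : 0 ≤ ∫ x, x ^ 2 ∂ν := integral_nonneg fun x => sq_nonneg x
  simp [abs_of_nonneg h0]

end CharFun

lemma norm_le_one_div_one_add_mul_of_rpow {E : Type*} [Norm E] {z : E} {a q s : ℝ} (ha : 0 ≤ a)
    (hq : 1 ≤ q) (h : ‖z‖ ≤ 1 / (1 + a * s ^ 2) ^ q) : ‖z‖ ≤ 1 / (1 + a * q * s ^ 2) := by
  have has : 0 ≤ a * s ^ 2 := by positivity
  refine h.trans (one_div_le_one_div_of_le (by positivity) ?_)
  calc 1 + a * q * s ^ 2 = 1 + q * (a * s ^ 2) := by ring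
    _ ≤ (1 + a * s ^ 2) ^ q := one_add_mul_self_le_rpow_one_add (by linarith) hq

namespace RandomSum

section Constants

lemma one_sub_log_two_nonneg : 0 ≤ 1 - Real.log 2 := by
  linarith [Real.log_two_lt_d9]

lemma k₁_nonneg : 0 ≤ k₁ := by
  have := one_sub_log_two_nonneg
  unfold k₁
  positivity

lemma k₂_nonneg : 0 ≤ k₂ := by
  unfold k₂
  positivity

lemma k₃_nonneg : 0 ≤ k₃ := by
  have := one_sub_log_two_nonneg
  unfold k₃
  positivity

lemma one_le_k₄ : 1 ≤ k₄ := by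
  have hsqrt2 : (1.41 : ℝ) ≤ √2 := Real.le_sqrt_of_sq_le (by norm_num)
  have hsqrt3 : (1.7 : ℝ) ≤ √3 := Real.le_sqrt_of_sq_le (by norm_num)
  have hlog : (2 : ℝ) ≤ Real.log 8 := by
    rw [show (8 : ℝ) = 2 ^ 3 by norm_num, Real.log_pow]
    push_cast
    linarith [Real.log_two_gt_d9]
  calc (1 : ℝ) ≤ 1.41 / 9 * (3 * 1.7 + 2) := by norm_num
    _ ≤ √2 / 9 * (Real.pi * √3 + Real.log 8) := by gcongr; exact Real.pi_gt_three.le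

lemma sqrt_three_div_sqrt_le {b C₂ C₃ : ℝ} (hb : 0 < b) (hb' : b ≤ 9 / 17) (hC₂ : 1 ≤ C₂)
    (hC₃ : 0 ≤ C₃) :
    √3 / √b ≤ 1 / b * (k₁ + C₃ * k₂ + 1 / √b * (C₂ * (k₃ + C₂ * k₄))) := by
  have hk₄ : 1 ≤ C₂ * (k₃ + C₂ * k₄) :=
    one_le_mul_of_one_le_of_one_le hC₂ <|
      le_add_of_nonneg_of_le k₃_nonneg (one_le_mul_of_one_le_of_one_le hC₂ one_le_k₄)
  have hsqrt : √3 * b ≤ 1 := by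
    calc √3 * b ≤ 17 / 9 * (9 / 17) := by
          gcongr
          exact Real.sqrt_le_iff.2 ⟨by norm_num, by norm_num⟩
      _ = 1 := by norm_num
  calc √3 / √b = 1 / b * (1 / √b * (√3 * b)) := by field_simp
    _ ≤ 1 / b * (1 / √b * (C₂ * (k₃ + C₂ * k₄))) := by
        exact mul_le_mul_of_nonneg_left
          (mul_le_mul_of_nonneg_left (hsqrt.trans hk₄) (by positivity)) (by positivity)
    _ ≤ 1 / b * (k₁ + C₃ * k₂ + 1 / √b * (C₂ * (k₃ + C₂ * k₄))) := by
        gcongr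
        exact le_add_of_nonneg_left (add_nonneg k₁_nonneg (mul_nonneg hC₃ k₂_nonneg))

end Constants

section RandomSums

variable {Ω : Type*} {n : ℕ} {η : Fin (n + 1) → Ω → ℝ} {f : Fin (n + 1) → ℂ → ℂ}

lemma scriptK_nonneg (f : Fin (n + 1) → ℂ → ℂ) (x : ℝ) : 0 ≤ scriptK f x :=
  div_nonneg (Real.sqrt_nonneg _) (Finset.sum_nonneg fun _ _ => sq_nonneg _)

lemma P_ofReal (hreal : ∀ k, ∀ x : ℝ, (f k x).im = 0) (ω : Ω) (x : ℝ) :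
    P η f ω x = ((∑ j, η j ω * (f j x).re : ℝ) : ℂ) := by
  unfold P
  push_cast
  exact Finset.sum_congr rfl fun j _ =>
    congrArg ((η j ω : ℂ) * ·) (Complex.ext rfl (by simp [hreal j x]))

lemma zeroCount_eq (hreal : ∀ k, ∀ x : ℝ, (f k x).im = 0) (S : Set ℝ) (ω : Ω) :
    zeroCount η f S ω = ({x | x ∈ S ∧ ∑ j, η j ω * (f j x).re = 0}.encard : ℝ≥0∞) := by
  simp_rw [zeroCount, P_ofReal hreal, Complex.ofReal_eq_zero]

lemma deriv_P_re {x : ℝ} (hf : ∀ k, DifferentiableAt ℂ (f k) x) (ω : Ω) :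
    (deriv (P η f ω) x).re = ∑ j, η j ω * (deriv (f j) x).re := by
  have hderiv : HasDerivAt (P η f ω) (∑ j, (η j ω : ℂ) * deriv (f j) x) (x : ℂ) :=
    HasDerivAt.fun_sum fun j _ => (hf j).hasDerivAt.const_mul (η j ω : ℂ)
  rw [hderiv.deriv, Complex.re_sum]
  exact Finset.sum_congr rfl fun j _ => Complex.re_ofReal_mul _ _

/-- The Kac–Rice intensity of the real zeros of `P η f`, where the `η k` are independent with laws
`ν k` and densities `p k`. -/
noncomputable def realZeroIntensity (ν : Fin (n + 1) → Measure ℝ) (p : Fin (n + 1) → ℝ → ℝ)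
    (f : Fin (n + 1) → ℂ → ℂ) (x : ℝ) : ℝ≥0∞ :=
  zeroIntensity ν p (fun j x => (f j x).re) (fun j x => (deriv (f j) x).re) x

lemma realZeroIntensity_le {ν : Fin (n + 1) → Measure ℝ} [∀ k, IsProbabilityMeasure (ν k)]
    {p : Fin (n + 1) → ℝ → ℝ} (hp : ∀ k, Continuous (p k))
    (hν : ∀ k, ν k = volume.withDensity fun x => ENNReal.ofReal (p k x)) {b : ℝ} (hb : 0 < b)
    (h : ∀ k s, ‖charFun (ν k) s‖ ≤ 1 / (1 + b * s ^ 2)) (h0 : ∀ k, ∫ x, x ∂ν k = 0)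
    (h2 : ∀ k, ∫ x, x ^ 2 ∂ν k = 1) {x : ℝ} (hx : K f x ≠ 0) :
    realZeroIntensity ν p f x ≤ ENNReal.ofReal (√3 / √b * scriptK f x) := by
  obtain ⟨k, hk⟩ := exists_mem_firstNonzero (g := fun j (x : ℝ) => (f j x).re) hx
  have hmem := fun i => memLp_two_of_integral_sq_ne_zero ((h2 i).trans_ne one_ne_zero)
  rw [realZeroIntensity, zeroIntensity_eq_of_mem hk]
  exact sliceIntegral_abs_le (g := fun j => (f j x).re) (hp k) (hν k) hb h hmem h0 h2 hk.1 _

variable [MeasurableSpace Ω] {μ : Measure Ω} [IsProbabilityMeasure μ]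
  (hη : ∀ k, AEMeasurable (η k) μ) (hindep : iIndepFun η μ)
  (hf : ∀ k, ∀ x : ℝ, DifferentiableAt ℂ (f k) x) (hreal : ∀ k, ∀ x : ℝ, (f k x).im = 0)
  {p : Fin (n + 1) → ℝ → ℝ}
  (hp : ∀ k, Continuous (p k))
  (hν : ∀ k, μ.map (η k) = volume.withDensity fun x => ENNReal.ofReal (p k x))

include hη hindep hf hreal hp hν

lemma lintegral_zeroCount_eq_lintegral_realZeroIntensity {S : Set ℝ} (hSm : MeasurableSet S)
    (hS : ∀ x ∈ S, K f x ≠ 0) :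
    AEMeasurable (zeroCount η f S) μ ∧ ∫⁻ ω, zeroCount η f S ω ∂μ
      = ∫⁻ x in S, realZeroIntensity (fun k => μ.map (η k)) p f x := by
  have := fun k => Measure.isProbabilityMeasure_map (hη k)
  have hd : ∀ j, ∀ x : ℝ, HasDerivAt (fun x : ℝ => (f j x).re) (deriv (f j) x).re x :=
    fun j x => (hf j x).hasDerivAt.real_of_complex
  obtain ⟨hmeas, hcount⟩ := kacRice (fun k => (hp k).measurable) hd hν hSm hS
  have hηm : AEMeasurable (fun ω j => η j ω) μ := aemeasurable_pi_iff.2 hη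
  rw [← (iIndepFun_iff_map_fun_eq_pi_map hη).1 hindep] at hmeas hcount
  simp_rw [funext (zeroCount_eq (η := η) hreal S)]
  exact ⟨hmeas.comp_aemeasurable hηm, (lintegral_map' hmeas hηm).symm.trans hcount⟩

variable (hp0 : ∀ k x, 0 ≤ p k x) {M : ℝ} (hpM : ∀ k x, p k x ≤ M)

include hp0 hpM

lemma exists_isJointDensity {x : ℝ} (hK : K f x ≠ 0) (hΔ : K11 f x * K f x - K01 f x ^ 2 ≠ 0) :
    ∃ D : ℝ × ℝ → ℝ,
      IsJointDensity μ (fun ω => (P η f ω x).re) (fun ω => (deriv (P η f ω) x).re) D ∧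
      realZeroIntensity (fun k => μ.map (η k)) p f x
        = ∫⁻ y, ENNReal.ofReal (|y| * D (0, y)) := by
  have := fun k => Measure.isProbabilityMeasure_map (hη k)
  obtain ⟨k, hk⟩ := exists_mem_firstNonzero (g := fun j (x : ℝ) => (f j x).re) hK
  obtain ⟨D, hD, hD0, hmap, hslice⟩ := exists_continuous_joint_density hp hp0 hpM hν
    (g := fun j => (f j x).re) (g' := fun j => (deriv (f j) x).re) hk.1 hΔ
  refine ⟨D, ⟨hD, hD0, ?_⟩, (zeroIntensity_eq_of_mem hk).trans hslice⟩
  rw [← hmap, ← (iIndepFun_iff_map_fun_eq_pi_map hη).1 hindep,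
    AEMeasurable.map_map_of_aemeasurable (by fun_prop) (aemeasurable_pi_iff.2 hη)]
  congr 1
  ext1 ω
  simp only [deriv_P_re (fun j => hf j x), P_ofReal hreal, Complex.ofReal_re, comp_apply]

theorem isRealZeroDensity_realZeroIntensity
    (hfin : ∀ x, K f x ≠ 0 → realZeroIntensity (fun k => μ.map (η k)) p f x ≠ ∞) :
    IsRealZeroDensity μ η f fun x => (realZeroIntensity (fun k => μ.map (η k)) p f x).toReal where
  measurable := by
    have := fun k => Measure.isProbabilityMeasure_map (hη k)
    exact (measurable_zeroIntensity (fun k => (hp k).measurable)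
      fun j x => (hf j x).hasDerivAt.real_of_complex).ennreal_toReal
  nonneg _ := ENNReal.toReal_nonneg
  aemeasurable_zeroCount _ hSm hS :=
    (lintegral_zeroCount_eq_lintegral_realZeroIntensity hη hindep hf hreal hp hν hSm hS).1
  lintegral_zeroCount S hSm hS := by
    rw [(lintegral_zeroCount_eq_lintegral_realZeroIntensity hη hindep hf hreal hp hν hSm hS).2]
    exact setLIntegral_congr_fun hSm fun x hx => (ENNReal.ofReal_toReal (hfin x (hS x hx))).symm
  kac_rice x hK hΔ := by
    obtain ⟨D, hD, hslice⟩ := exists_isJointDensity hη hindep hf hreal hp hν hp0 hpM hK hΔ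
    have hnonneg : ∀ᵐ y : ℝ, 0 ≤ |y| * D (0, y) :=
      Eventually.of_forall fun y => mul_nonneg (abs_nonneg y) (hD.2.1 _)
    have hmeas : AEStronglyMeasurable fun y : ℝ => |y| * D (0, y) :=
      (continuous_abs.mul (hD.1.comp (by fun_prop))).aestronglyMeasurable
    refine ⟨D, hD, ⟨hmeas, ?_⟩, ?_⟩
    · rw [hasFiniteIntegral_iff_ofReal hnonneg, ← hslice]
      exact (hfin x hK).lt_top
    · rw [hslice, integral_eq_lintegral_of_nonneg_ae hnonneg hmeas]

end RandomSums

lemma sqrt_three_div_sqrt_mul_scriptK_le {n : ℕ} (f : Fin (n + 1) → ℂ → ℂ) (x : ℝ)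
    {Ω : Type*} [MeasurableSpace Ω] {μ : Measure Ω} [IsProbabilityMeasure μ] {X : Ω → ℝ}
    (hX : AEMeasurable X μ) (hvar : ∫ ω, X ω ^ 2 ∂μ = 1) {a q C₂ C₃ : ℝ} (ha : 0 < a) (hq : 1 ≤ q)
    (hdecay : ∀ s, ‖charFun (μ.map X) s‖ ≤ 1 / (1 + a * s ^ 2) ^ q)
    (hC₂ : ‖iteratedDeriv 2 (charFun (μ.map X)) 0‖ ≤ C₂) (hC₃ : 0 ≤ C₃) :
    √3 / √(a * q) * scriptK f x
      ≤ scriptK f x * (1 / (a * q)) *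
        (k₁ + C₃ * k₂ + 1 / √(a * q) * (C₂ * (k₃ + C₂ * k₄))) := by
  have := Measure.isProbabilityMeasure_map hX
  have hb : 0 < a * q := mul_pos ha (zero_lt_one.trans_le hq)
  have hchar := fun s => norm_le_one_div_one_add_mul_of_rpow ha.le hq (hdecay s)
  have h2 : ∫ x, x ^ 2 ∂μ.map X = 1 := (integral_map hX (by fun_prop)).trans hvar
  have hmem := memLp_two_of_integral_sq_ne_zero (h2.trans_ne one_ne_zero)
  rw [norm_iteratedDeriv_two_charFun_zero hmem, h2] at hC₂
  rw [mul_comm, mul_assoc]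
  exact mul_le_mul_of_nonneg_left
    (sqrt_three_div_sqrt_le hb (le_of_norm_charFun_le hb h2 hchar) hC₂ hC₃) (scriptK_nonneg f x)

end RandomSum

theorem theorem2_general {Ω : Type*} [MeasurableSpace Ω] {μ : Measure Ω} [IsProbabilityMeasure μ]
    {n : ℕ} {η : Fin (n + 1) → Ω → ℝ} (hη : ∀ k, AEMeasurable (η k) μ) (hindep : iIndepFun η μ)
    (hmean : ∀ k, ∫ ω, η k ω ∂μ = 0) (hvar : ∀ k, ∫ ω, η k ω ^ 2 ∂μ = 1)
    {f : Fin (n + 1) → ℂ → ℂ} (hf : ∀ k, ∀ x : ℝ, DifferentiableAt ℂ (f k) x)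
    (hreal : ∀ k, ∀ x : ℝ, (f k x).im = 0) {a q : ℝ} (ha : 0 < a) (hq : 1 ≤ q)
    (hdecay : ∀ k s, ‖charFun (μ.map (η k)) s‖ ≤ 1 / (1 + a * s ^ 2) ^ q) :
    ∃ ρ : ℝ → ℝ, RandomSum.IsRealZeroDensity μ η f ρ ∧
      ∀ x : ℝ, RandomSum.K f x ≠ 0 → ρ x ≤ √3 / √(a * q) * RandomSum.scriptK f x := by
  have hb : 0 < a * q := mul_pos ha (zero_lt_one.trans_le hq)
  have hchar : ∀ k s, ‖charFun (μ.map (η k)) s‖ ≤ 1 / (1 + a * q * s ^ 2) := fun k s =>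
    norm_le_one_div_one_add_mul_of_rpow ha.le hq (hdecay k s)
  have := fun k => Measure.isProbabilityMeasure_map (hη k)
  have h0 : ∀ k, ∫ x, x ∂μ.map (η k) = 0 := fun k =>
    (integral_map (hη k) (by fun_prop)).trans (hmean k)
  have h2 : ∀ k, ∫ x, x ^ 2 ∂μ.map (η k) = 1 := fun k =>
    (integral_map (hη k) (by fun_prop)).trans (hvar k)
  choose p hp hp0 hpM hν using fun k => exists_continuous_density_of_norm_charFun_le _ hb (hchar k)
  have hbound := fun x (hx : RandomSum.K f x ≠ 0) =>
    RandomSum.realZeroIntensity_le hp hν hb hchar h0 h2 hx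
  refine ⟨_, RandomSum.isRealZeroDensity_realZeroIntensity hη hindep hf hreal hp hν hp0 hpM
    fun x hx => ne_top_of_le_ne_top ENNReal.ofReal_ne_top (hbound x hx), fun x hx => ?_⟩
  have := RandomSum.scriptK_nonneg f x
  exact ENNReal.toReal_le_of_le_ofReal (by positivity) (hbound x hx)

theorem theorem2 {Ω : Type*} [MeasurableSpace Ω] (μ : Measure Ω) [IsProbabilityMeasure μ]
    (n : ℕ) (η : Fin (n + 1) → Ω → ℝ)
    (hη : ∀ k, Measurable (η k))
    (hindep : iIndepFun η μ)
    (hident : ∀ i j, IdentDistrib (η i) (η j) μ μ)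
    (hmean : ∀ k, ∫ ω, η k ω ∂μ = 0)
    (hvar : ∀ k, ∫ ω, η k ω ^ 2 ∂μ = 1)
    (f : Fin (n + 1) → ℂ → ℂ)
    (hf : ∀ k, Differentiable ℂ (f k))
    (hreal : ∀ k, ∀ x : ℝ, (f k x).im = 0)
    (φ : ℝ → ℂ) (hφ : ∀ k, φ = charFun (μ.map (η k)))
    (a q C₂ C₃ : ℝ) (ha : 0 < a) (hq : 1 ≤ q) (hC₂ : 0 < C₂) (hC₃ : 0 < C₃)
    (hdecay : ∀ s : ℝ, ‖φ s‖ ≤ 1 / (1 + a * s ^ 2) ^ q)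
    (hdiff : ∀ j < 3, Differentiable ℝ (iteratedDeriv j φ))
    (hφ₂ : ∀ s : ℝ, ‖iteratedDeriv 2 φ s‖ ≤ C₂)
    (hφ₃ : ∀ s : ℝ, ‖iteratedDeriv 3 φ s‖ ≤ C₃) :
    ∃ ρ : ℝ → ℝ, RandomSum.IsRealZeroDensity μ η f ρ ∧
      ∀ x : ℝ, RandomSum.K f x ≠ 0 →
        ρ x ≤ RandomSum.scriptK f x * (1 / (a * q)) *
          (RandomSum.k₁ + C₃ * RandomSum.k₂ +
            1 / √(a * q) * (C₂ * (RandomSum.k₃ + C₂ * RandomSum.k₄))) := by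
  obtain ⟨ρ, hρ, hbound⟩ := theorem2_general (fun k => (hη k).aemeasurable) hindep hmean hvar
    (fun k x => hf k x) hreal ha hq fun k => hφ k ▸ hdecay
  exact ⟨ρ, hρ, fun x hx => (hbound x hx).trans <| RandomSum.sqrt_three_div_sqrt_mul_scriptK_le f x
    (hη 0).aemeasurable (hvar 0) ha hq (hφ 0 ▸ hdecay) (hφ 0 ▸ hφ₂ 0) hC₃.le⟩
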